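/- **Setting.** For sequences $x\in\mathbb C^{\mathbb Z}$ let $[\Delta x]_t=x_{t-1}$, $[u*v]_t=\sum_{\tau\in\mathbb Z}u_\tau v_{t-\tau}$, $\mathbb C(\mathbb Z_{a,b})=\{u: u_t=0 \text{ for } t\notin[a,b]\}$, $\|x\|_{n,2}=\big(\sum_{t=0}^n|x_t|^2\big)^{1/2}$, and let $\|x\|^F_{n,1}$ be the $\ell_1$-norm of the unitary discrete Fourier transform $\big((n+1)^{-1/2}\sum_{t=0}^n x_te^{2\pi i jt/(n+1)}\big)_{0\le j\le n}$ of $(x_0,\dots,x_n)$. One observes $y_t=x_t+\sigma\zeta_t$, where $\sigma>0$ and the $\zeta_t$, $t\in\mathbb Z$, are i.i.d. with the law of $\xi^1+i\xi^2$ for independent $\xi^1,\xi^2\sim\mathcal N(0,1)$. The signal $x$ is *$(m,n,k_0,\varrho)$-interpolable*, where $\varrho\ge1$ and $0\le k_0\le m$, if there is a filter $\varphi\in\mathbb C(\mathbb Z_{-k_0,m-k_0})$ with $\mathbf E|x_t-[\varphi*y]_t|^2\le \frac{\varrho\sigma^2}{m+1}$ for all $-m-k_0\le t\le n-k_0$.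 *Assumption 1* (with parameters $s$ and $\varkappa\ge0$): $x=x^{\mathcal S}+\varepsilon$, where $x^{\mathcal S}$ belongs to a shift-invariant ($\Delta\mathcal S\subseteq\mathcal S$) complex linear subspace $\mathcal S$ of $\mathbb C^{\mathbb Z}$ of dimension $s$, $1\le s\le n+1$, and $\|\Delta^\tau\varepsilon\|_{n,2}\le\varkappa\sigma$ for all $0\le\tau\le n$. The *$k$-interpolating constrained least-squares estimator* of $x$ is $\widehat\varphi*y$, where $\widehat\varphi$ is any minimizer of $\|\Delta^k[y-\varphi*y]\|_{n,2}^2$ over all $\varphi\in\mathbb C(\mathbb Z_{-k,n-k})$ with $\|\Delta^k\varphi\|^F_{n,1}\le\overline\varrho/\sqrt{n+1}$. **Proposition.** There is an absolute constant $C>0$ such that the following holds. Let $m\ge1$, $n=2m$, let $x$ be $(m,n,k_0,\varrho)$-interpolable, and let Assumption 1 hold. Let $\widehat\varphi$ be as above with $\overline\varrho=2\varrho$ and $k=2k_0$. Then for every $\alpha\in(0,1)$ there is a set $\Xi_\alpha$ of realizations of the noise $\zeta$ with $\mathbb P\{\zeta\in\Xi_\alpha\}\ge1-\alpha$ such that,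 whenever $\zeta\in\Xi_\alpha$, every such $\widehat\varphi$ satisfies $$\big\|\Delta^{2k_0}[x-\widehat\varphi*y]\big\|_{n,2}^2\le C\sigma^2\big[\varrho^2(1+\ln(1/\alpha))+E_0\big],$$ $$\big|[x-\widehat\varphi*y]_t\big|^2\le C\,\frac{\sigma^2\varrho}{n+1}\big[\varrho^2(1+\ln(1/\alpha))+E_0\big]\quad\text{for all integers } t\in[m-3k_0,\,n-3k_0],$$ where $$E_0=\varrho\ln\frac{2n}{\alpha}+\varrho\varkappa\sqrt{\ln\frac{16}{\alpha}}+s.$$ -/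

import Mathlib

/-!
By the bias–variance decomposition, the oracle filter `φ` of an interpolable signal has small
energy and small bias. The Fourier `ℓ₁`-norm of `φ * φ` is proportional to the energy of `φ`, so
`φ * φ` is feasible for the least-squares problem, and since `1 - φ * φ = (1 + φ) * (1 - φ)` it
still reproduces `x` well. Minimality of `φhat` therefore bounds its error by that of `φ * φ`, up
to the correlations of the noise with the two residuals.

To control the correlation with the data-dependent residual of `φhat`, split the fitting window
along the restrictions of the shift-invariant space `S`. The noise component along `S` has energy of
order `s`. Orthogonally to `S` both `x^S` and `φhat * x^S` vanish, and `φhat`, being feasible, is a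
combination of `n + 1` Fourier atoms with small `ℓ₁`-norm. This leaves a maximum of `n + 1` fixed
quadratic forms of the noise, whose exponential moments are bounded by decoupling.

For the pointwise bound, convolve the error with `φ`: what is filtered is controlled by the
`ℓ₂`-bound and the small energy of `φ`, and `1 - φ` commutes past `1 - φhat` and acts on `x`.
-/

open MeasureTheory ProbabilityTheory

namespace SignalDenoising

/-- Two-sided complex sequences, the space `ℂ(ℤ)`. -/
abbrev Signal : Type := ℤ → ℂ

/-- The shift `Δ^k`, where `(Δ x)_t = x_{t-1}`; `k` may be any integer. -/
def shift (k : ℤ) (x : Signal) : Signal := fun t => x (t - k)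

/-- The convolution `(u * v)_t = ∑_{τ ∈ ℤ} u_τ v_{t-τ}`. It is used only for a finitely
supported `u`, so that the sum has finitely many nonzero terms. -/
noncomputable def conv (u v : Signal) : Signal := fun t => ∑' τ : ℤ, u τ * v (t - τ)

/-- `u` belongs to `ℂ(ℤ_{a,b})`, i.e. `u_t = 0` for `t ∉ [a, b]`. -/
def SupportedOn (a b : ℤ) (u : Signal) : Prop := ∀ t : ℤ, t ∉ Set.Icc a b → u t = 0

/-- `‖x‖_{n,2}`, the Euclidean norm of `(x_0, …, x_n)`. -/
noncomputable def l2Norm (n : ℕ) (x : Signal) : ℝ :=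
  Real.sqrt (∑ t ∈ Finset.range (n + 1), ‖x (t : ℤ)‖ ^ 2)

/-- The `k`-th entry of the unitary discrete Fourier transform of `(x_0, …, x_n)`. -/
noncomputable def dft (n : ℕ) (x : Signal) (k : ℕ) : ℂ :=
  ((Real.sqrt ((n : ℝ) + 1))⁻¹ : ℂ) *
    ∑ t ∈ Finset.range (n + 1),
      x (t : ℤ) * Complex.exp (2 * Real.pi * Complex.I * (k : ℂ) * (t : ℂ) / ((n : ℂ) + 1))

/-- `‖x‖^F_{n,1}`, the `ℓ₁`-norm of the unitary discrete Fourier transform of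
`(x_0, …, x_n)`. -/
noncomputable def fourierL1Norm (n : ℕ) (x : Signal) : ℝ :=
  ∑ k ∈ Finset.range (n + 1), ‖dft n x k‖

/-- The law of `ξ₁ + i ξ₂` with `ξ₁, ξ₂` independent real standard normal. -/
noncomputable def stdComplexGaussian : Measure ℂ :=
  ((gaussianReal 0 1).prod (gaussianReal 0 1)).map
    (fun p : ℝ × ℝ => (p.1 : ℂ) + (p.2 : ℂ) * Complex.I)

/-- `ζ = (ζ_t)_{t ∈ ℤ}` is a sequence of i.i.d. standard complex Gaussian variables. -/
structure IsStdComplexNoise {Ω : Type*} [MeasurableSpace Ω] (P : Measure Ω)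
    (ζ : ℤ → Ω → ℂ) : Prop where
  measurable : ∀ t, Measurable (ζ t)
  indep : iIndepFun ζ P
  law : ∀ t, P.map (ζ t) = stdComplexGaussian

/-- The observations `y_t = x_t + σ z_t` for a noise realization `z`. -/
def observe (x : Signal) (σ : ℝ) (z : Signal) : Signal := fun t => x t + (σ : ℂ) * z t

/-- `x` is `(m, n, k, ρ)`-interpolable: `ρ ≥ 1`, `0 ≤ k ≤ m`, and some filter
`φ ∈ ℂ(ℤ_{-k,m-k})` satisfies `E |x_t - (φ * y)_t|² ≤ ρ σ² / (m + 1)` for all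
`-m - k ≤ t ≤ n - k`. -/
def Interpolable {Ω : Type*} [MeasurableSpace Ω] (P : Measure Ω) (ζ : ℤ → Ω → ℂ) (σ : ℝ)
    (m n k : ℕ) (ρ : ℝ) (x : Signal) : Prop :=
  1 ≤ ρ ∧ k ≤ m ∧
    ∃ φ : Signal, SupportedOn (-(k : ℤ)) ((m : ℤ) - k) φ ∧
      ∀ t : ℤ, -(m : ℤ) - k ≤ t → t ≤ (n : ℤ) - k →
        ∫ ω, ‖x t - conv φ (observe x σ (fun u => ζ u ω)) t‖ ^ 2 ∂P
          ≤ ρ * σ ^ 2 / ((m : ℝ) + 1)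

/-- Closeness of `x` to a shift-invariant subspace, for filters of bandwidth `m` and
validation length `n`: `x = xS + ε`, where `xS` lies in an `s`-dimensional complex subspace
`S` of `ℂ(ℤ)` with `Δ S ⊆ S`, `1 ≤ s ≤ n + 1`, and `‖Δ^τ ε‖_{n,2} ≤ κ σ` for
`0 ≤ τ ≤ m`. -/
def NearShiftInvariant (m n : ℕ) (σ : ℝ) (s : ℕ) (κ : ℝ) (x : Signal) : Prop :=
  1 ≤ s ∧ s ≤ n + 1 ∧ 0 ≤ κ ∧
    ∃ S : Submodule ℂ Signal,
      (∀ u ∈ S, shift 1 u ∈ S) ∧ Module.finrank ℂ S = s ∧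
      ∃ xS ε : Signal, xS ∈ S ∧ x = xS + ε ∧
        ∀ τ : ℕ, τ ≤ m → l2Norm n (shift τ ε) ≤ κ * σ

/-- The feasible set of the `k`-interpolating constrained least-squares problem. -/
def feasibleFilters (n k : ℕ) (ρbar : ℝ) : Set Signal :=
  {φ | SupportedOn (-(k : ℤ)) ((n : ℤ) - k) φ ∧
    fourierL1Norm n (shift k φ) ≤ ρbar / Real.sqrt ((n : ℝ) + 1)}

/-- `φ` is an optimal solution of the `k`-interpolating constrained least-squares problem
with observations `y`. -/
def IsInterpolatingLS (n k : ℕ) (ρbar : ℝ) (y φ : Signal) : Prop :=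
  φ ∈ feasibleFilters n k ρbar ∧
    ∀ ψ ∈ feasibleFilters n k ρbar,
      l2Norm n (shift k (y - conv φ y)) ^ 2 ≤ l2Norm n (shift k (y - conv ψ y)) ^ 2

/-- The remainder term for filters of bandwidth `m` and validation length `n`; here
`(n + 1) / (m + 1)` is the squared skewness factor, equal to `1` when `m = n`. -/
noncomputable def remainder (m n : ℕ) (ρ : ℝ) (s : ℕ) (κ α : ℝ) : ℝ :=
  ρ * (((n : ℝ) + 1) / ((m : ℝ) + 1)) * Real.log (((m : ℝ) + n) / α)
    + ρ * κ * Real.sqrt (Real.log (16 / α)) + s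

end SignalDenoising

namespace SignalDenoising

open scoped ComplexConjugate ENNReal

section StdComplexGaussian

lemma measurable_ofReal_add_mul_I :
    Measurable (fun p : ℝ × ℝ => (p.1 : ℂ) + (p.2 : ℂ) * Complex.I) := by fun_prop

instance : IsProbabilityMeasure stdComplexGaussian :=
  Measure.isProbabilityMeasure_map measurable_ofReal_add_mul_I.aemeasurable

instance : IsGaussian stdComplexGaussian := by
  let L : ℝ × ℝ →L[ℝ] ℂ :=
    Complex.ofRealCLM.comp (ContinuousLinearMap.fst ℝ ℝ ℝ)
      + (ContinuousLinearMap.mul ℝ ℂ).flip Complex.I ∘L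
        Complex.ofRealCLM.comp (ContinuousLinearMap.snd ℝ ℝ ℝ)
  exact isGaussian_map (μ := (gaussianReal 0 1).prod (gaussianReal 0 1)) L

lemma integral_stdComplexGaussian {E : Type*} [NormedAddCommGroup E] [NormedSpace ℝ E]
    {f : ℂ → E} (hf : AEStronglyMeasurable f stdComplexGaussian) :
    ∫ z, f z ∂stdComplexGaussian
      = ∫ p : ℝ × ℝ, f (p.1 + p.2 * Complex.I) ∂(gaussianReal 0 1).prod (gaussianReal 0 1) :=
  integral_map measurable_ofReal_add_mul_I.aemeasurable hf

lemma integral_exp_mul_gaussianReal (c : ℝ) :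
    ∫ x, Real.exp (c * x) ∂(gaussianReal 0 1) = Real.exp (c ^ 2 / 2) := by
  simpa [mgf] using congrFun (mgf_id_gaussianReal (μ := 0) (v := 1)) c

lemma integral_exp_sq_gaussianReal :
    ∫ x, Real.exp (x ^ 2 / 4) ∂(gaussianReal 0 1) = √2 := by
  have density_mul (x : ℝ) : gaussianPDFReal 0 1 x • Real.exp (x ^ 2 / 4)
      = (√(2 * Real.pi))⁻¹ * Real.exp (-(1 / 4) * x ^ 2) := by
    rw [gaussianPDFReal_def, smul_eq_mul]
    simp only [NNReal.coe_one, mul_one, sub_zero]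
    rw [mul_assoc, ← Real.exp_add]
    ring_nf
  simp_rw [integral_gaussianReal_eq_integral_smul one_ne_zero, density_mul]
  rw [integral_const_mul, integral_gaussian, ← Real.sqrt_inv, ← Real.sqrt_mul (by positivity)]
  congr 1
  field_simp
  norm_num

lemma integral_exp_re_mul_stdComplexGaussian (c : ℂ) :
    ∫ z, Real.exp ((c * z).re) ∂stdComplexGaussian = Real.exp (‖c‖ ^ 2 / 2) := by
  have exp_split (p : ℝ × ℝ) : Real.exp ((c * ((p.1 : ℂ) + (p.2 : ℂ) * Complex.I)).re)
      = Real.exp (c.re * p.1) * Real.exp (-c.im * p.2) := by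
    rw [← Real.exp_add]
    congr 1
    simp
    ring
  rw [integral_stdComplexGaussian (by fun_prop)]
  simp_rw [exp_split]
  rw [integral_prod_mul (fun x => Real.exp (c.re * x)) (fun x => Real.exp (-c.im * x)),
    integral_exp_mul_gaussianReal, integral_exp_mul_gaussianReal, ← Real.exp_add,
    Complex.sq_norm, Complex.normSq_apply]
  ring_nf

lemma norm_sq_ofReal_add_mul_I (a b : ℝ) :
    ‖(a : ℂ) + (b : ℂ) * Complex.I‖ ^ 2 = a ^ 2 + b ^ 2 := by
  rw [Complex.sq_norm, Complex.normSq_add_mul_I]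

lemma integral_exp_norm_sq_stdComplexGaussian :
    ∫ z, Real.exp (‖z‖ ^ 2 / 4) ∂stdComplexGaussian = 2 := by
  rw [integral_stdComplexGaussian (by fun_prop)]
  simp_rw [norm_sq_ofReal_add_mul_I, add_div, Real.exp_add]
  rw [integral_prod_mul (fun x => Real.exp (x ^ 2 / 4)) (fun x => Real.exp (x ^ 2 / 4)),
    integral_exp_sq_gaussianReal, Real.mul_self_sqrt zero_le_two]

lemma integral_id_stdComplexGaussian : ∫ z, z ∂stdComplexGaussian = 0 := by
  have integrable_id : Integrable (fun x : ℝ => x) (gaussianReal 0 1) := IsGaussian.integrable_id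
  have integrable_fst : Integrable (fun p : ℝ × ℝ => (p.1 : ℂ))
      ((gaussianReal 0 1).prod (gaussianReal 0 1)) := (integrable_id.comp_fst _).ofReal
  have integrable_snd : Integrable (fun p : ℝ × ℝ => (p.2 : ℂ) * Complex.I)
      ((gaussianReal 0 1).prod (gaussianReal 0 1)) :=
    (integrable_id.comp_snd _).ofReal.mul_const _
  rw [integral_stdComplexGaussian (by fun_prop), integral_add integrable_fst integrable_snd,
    integral_mul_const, integral_complex_ofReal, integral_complex_ofReal,
    integral_fun_fst (fun x : ℝ => x), integral_fun_snd (fun x : ℝ => x)]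
  simp

lemma integral_sq_gaussianReal : ∫ x, x ^ 2 ∂(gaussianReal 0 1) = 1 := by
  have variance_eq := variance_fun_id_gaussianReal (μ := 0) (v := 1)
  rw [variance_of_integral_eq_zero (by fun_prop) (by simp)] at variance_eq
  simpa using variance_eq

lemma integral_norm_sq_stdComplexGaussian : ∫ z, ‖z‖ ^ 2 ∂stdComplexGaussian = 2 := by
  have integrable_sq : Integrable (fun x : ℝ => x ^ 2) (gaussianReal 0 1) :=
    (IsGaussian.memLp_two_id (μ := gaussianReal 0 1)).integrable_sq
  rw [integral_stdComplexGaussian (by fun_prop)]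
  simp_rw [norm_sq_ofReal_add_mul_I]
  rw [integral_add (integrable_sq.comp_fst _) (integrable_sq.comp_snd _),
    integral_fun_fst (fun x : ℝ => x ^ 2), integral_fun_snd (fun x : ℝ => x ^ 2),
    integral_sq_gaussianReal]
  norm_num

end StdComplexGaussian

/-- The law of a vector of i.i.d. standard complex Gaussian variables, on Euclidean space. -/
noncomputable def complexGaussian (ι : Type*) [Fintype ι] : Measure (EuclideanSpace ℂ ι) :=
  (Measure.pi fun _ : ι => stdComplexGaussian).map (WithLp.toLp 2)

section ComplexGaussian

variable {ι : Type*} [Fintype ι]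

instance : IsProbabilityMeasure (complexGaussian ι) :=
  Measure.isProbabilityMeasure_map (by fun_prop)

lemma iIndepFun_eval_pi_stdComplexGaussian :
    iIndepFun (fun (i : ι) (z : ι → ℂ) => z i) (Measure.pi fun _ : ι => stdComplexGaussian) :=
  iIndepFun_pi (X := fun _ => id) (fun _ => aemeasurable_id)

instance : IsGaussian (complexGaussian ι) := by
  have hasGaussianLaw_eval (i : ι) : HasGaussianLaw (fun z : ι → ℂ => z i)
      (Measure.pi fun _ : ι => stdComplexGaussian) := by
    constructor
    rw [(measurePreserving_eval (fun _ : ι => stdComplexGaussian) i).map_eq]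
    infer_instance
  exact ((iIndepFun.hasGaussianLaw hasGaussianLaw_eval
    iIndepFun_eval_pi_stdComplexGaussian).toLp_pi 2).isGaussian_map

lemma integral_complexGaussian {E : Type*} [NormedAddCommGroup E] [NormedSpace ℝ E]
    {f : EuclideanSpace ℂ ι → E} (hf : AEStronglyMeasurable f (complexGaussian ι)) :
    ∫ z, f z ∂complexGaussian ι
      = ∫ z, f (WithLp.toLp 2 z) ∂(Measure.pi fun _ : ι => stdComplexGaussian) :=
  integral_map (by fun_prop) hf

lemma integral_exp_re_inner_complexGaussian (a : EuclideanSpace ℂ ι) :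
    ∫ z, Real.exp (inner ℂ a z).re ∂complexGaussian ι = Real.exp (‖a‖ ^ 2 / 2) := by
  have exp_prod (z : ι → ℂ) : Real.exp (inner ℂ a (WithLp.toLp 2 z : EuclideanSpace ℂ ι)).re
      = ∏ i, Real.exp ((conj (a i) * z i).re) := by
    rw [← Real.exp_sum, PiLp.inner_apply, Complex.re_sum]
    simp [mul_comm]
  rw [integral_complexGaussian (by fun_prop)]
  simp_rw [exp_prod]
  rw [integral_fintype_prod_eq_prod (f := fun i x => Real.exp ((conj (a i) * x).re))]
  simp_rw [integral_exp_re_mul_stdComplexGaussian]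
  rw [← Real.exp_sum, EuclideanSpace.norm_sq_eq, Finset.sum_div]
  simp

lemma lintegral_exp_re_inner_complexGaussian (a : EuclideanSpace ℂ ι) :
    ∫⁻ z, ENNReal.ofReal (Real.exp (inner ℂ a z).re) ∂complexGaussian ι
      = ENNReal.ofReal (Real.exp (‖a‖ ^ 2 / 2)) := by
  rw [← integral_exp_re_inner_complexGaussian a, ofReal_integral_eq_lintegral_ofReal
    (.of_integral_ne_zero (by simp [integral_exp_re_inner_complexGaussian]))
    (ae_of_all _ fun _ => (Real.exp_pos _).le)]

lemma integral_exp_norm_sq_complexGaussian :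
    ∫ z, Real.exp (‖z‖ ^ 2 / 4) ∂complexGaussian ι = 2 ^ Fintype.card ι := by
  have exp_prod (z : ι → ℂ) : Real.exp (‖(WithLp.toLp 2 z : EuclideanSpace ℂ ι)‖ ^ 2 / 4)
      = ∏ i, Real.exp (‖z i‖ ^ 2 / 4) := by
    rw [← Real.exp_sum, EuclideanSpace.norm_sq_eq, Finset.sum_div]
  rw [integral_complexGaussian (by fun_prop)]
  simp_rw [exp_prod]
  rw [integral_fintype_prod_eq_prod (f := fun i x => Real.exp (‖x‖ ^ 2 / 4))]
  simp [integral_exp_norm_sq_stdComplexGaussian]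

lemma lintegral_exp_norm_sq_complexGaussian :
    ∫⁻ z, ENNReal.ofReal (Real.exp (‖z‖ ^ 2 / 4)) ∂complexGaussian ι
      = ENNReal.ofReal (2 ^ Fintype.card ι) := by
  rw [← integral_exp_norm_sq_complexGaussian, ofReal_integral_eq_lintegral_ofReal
    (.of_integral_ne_zero (by simp [integral_exp_norm_sq_complexGaussian]))
    (ae_of_all _ fun _ => (Real.exp_pos _).le)]

lemma integral_coord_complexGaussian (i : ι) : ∫ z, z i ∂complexGaussian ι = 0 := by
  rw [integral_complexGaussian (f := fun z => z i) (by fun_prop)]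
  exact (integral_comp_eval (μ := fun _ : ι => stdComplexGaussian) (i := i) (f := fun z : ℂ => z)
    (by fun_prop)).trans integral_id_stdComplexGaussian

lemma integral_id_complexGaussian : ∫ z, id z ∂complexGaussian ι = 0 := by
  ext i
  exact (ContinuousLinearMap.integral_comp_comm
    ((EuclideanSpace.proj i : EuclideanSpace ℂ ι →L[ℂ] ℂ).restrictScalars ℝ)
    (IsGaussian.integrable_id (μ := complexGaussian ι))).symm.trans
      (integral_coord_complexGaussian i)

lemma integral_clm_complexGaussian (L : EuclideanSpace ℂ ι →L[ℝ] ℝ) :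
    ∫ z, L z ∂complexGaussian ι = 0 := by
  have integral_id := L.integral_comp_comm (IsGaussian.integrable_id (μ := complexGaussian ι))
  rwa [integral_id_complexGaussian, map_zero] at integral_id

lemma memLp_coord_complexGaussian (i : ι) : MemLp (fun z => z i) 2 (complexGaussian ι) :=
  ((EuclideanSpace.proj i : EuclideanSpace ℂ ι →L[ℂ] ℂ).restrictScalars ℝ).comp_memLp'
    (IsGaussian.memLp_two_id (μ := complexGaussian ι))

lemma integrable_conj_mul_coord_complexGaussian (i j : ι) :
    Integrable (fun z => conj (z i) * z j) (complexGaussian ι) :=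
  (memLp_coord_complexGaussian i).star.integrable_mul (memLp_coord_complexGaussian j)

lemma integral_conj_mul_coord_complexGaussian [DecidableEq ι] (i j : ι) :
    ∫ z, conj (z i) * z j ∂complexGaussian ι = if i = j then 2 else 0 := by
  rw [integral_complexGaussian (f := fun z => conj (z i) * z j) (by fun_prop)]
  split_ifs with hij
  · subst hij
    have conj_mul_self (z : ι → ℂ) : conj (z i) * z i = ((‖z i‖ ^ 2 : ℝ) : ℂ) := by
      rw [Complex.conj_mul', Complex.ofReal_pow]
    simp_rw [conj_mul_self]
    rw [integral_complex_ofReal, integral_comp_eval (μ := fun _ : ι => stdComplexGaussian)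
      (f := fun z : ℂ => ‖z‖ ^ 2) (by fun_prop), integral_norm_sq_stdComplexGaussian]
    norm_num
  · have indep : IndepFun (fun z : ι → ℂ => conj (z i)) (fun z : ι → ℂ => z j)
        (Measure.pi fun _ : ι => stdComplexGaussian) :=
      (iIndepFun_eval_pi_stdComplexGaussian.indepFun hij).comp (φ := fun w : ℂ => conj w)
        (ψ := id) (by fun_prop) measurable_id
    refine (indep.integral_mul_eq_mul_integral
      (Complex.continuous_conj.measurable.comp (measurable_pi_apply i)).aestronglyMeasurable
      (measurable_pi_apply j).aestronglyMeasurable).trans ?_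
    rw [integral_comp_eval (μ := fun _ : ι => stdComplexGaussian) (f := fun z : ℂ => z)
      (by fun_prop), integral_id_stdComplexGaussian, mul_zero]

end ComplexGaussian

section ExponentialMoments

variable {ι κ : Type*} [Fintype ι]

lemma norm_inv_sqrt_two_smul_sq {E : Type*} [NormedAddCommGroup E] [NormedSpace ℂ E] (v : E) :
    ‖(((√2)⁻¹ : ℝ) : ℂ) • v‖ ^ 2 = ‖v‖ ^ 2 / 2 := by
  rw [norm_smul, mul_pow, Complex.norm_real, Real.norm_eq_abs, sq_abs, inv_pow,
    Real.sq_sqrt zero_le_two]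
  ring

-- Write `exp (‖A z‖² / 4)` as a Gaussian average of `exp (Re ⟪A z / √2, g⟫)` and swap `z` and `g`.
lemma lintegral_exp_norm_sq_apply_eq_adjoint [Fintype κ]
    (A : EuclideanSpace ℂ ι →L[ℂ] EuclideanSpace ℂ κ) :
    ∫⁻ z, ENNReal.ofReal (Real.exp (‖A z‖ ^ 2 / 4)) ∂complexGaussian ι
      = ∫⁻ g, ENNReal.ofReal (Real.exp (‖ContinuousLinearMap.adjoint A g‖ ^ 2 / 4))
          ∂complexGaussian κ := by
  let r : ℂ := ((√2)⁻¹ : ℝ)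
  have re_inner_swap (z : EuclideanSpace ℂ ι) (g : EuclideanSpace ℂ κ) :
      (inner ℂ (r • A z) g).re = (inner ℂ (r • ContinuousLinearMap.adjoint A g) z).re := by
    rw [inner_smul_left, inner_smul_left, ContinuousLinearMap.adjoint_inner_left,
      Complex.conj_ofReal, Complex.re_ofReal_mul, Complex.re_ofReal_mul, ← inner_conj_symm g,
      Complex.conj_re]
  calc _ = ∫⁻ z, ∫⁻ g, ENNReal.ofReal (Real.exp (inner ℂ (r • A z) g).re)
          ∂complexGaussian κ ∂complexGaussian ι := by
        simp_rw [lintegral_exp_re_inner_complexGaussian, r, norm_inv_sqrt_two_smul_sq, div_div]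
        norm_num
    _ = ∫⁻ g, ∫⁻ z, ENNReal.ofReal (Real.exp (inner ℂ (r • A z) g).re)
          ∂complexGaussian ι ∂complexGaussian κ :=
        lintegral_lintegral_swap (by fun_prop)
    _ = _ := by
        simp_rw [re_inner_swap, lintegral_exp_re_inner_complexGaussian, r,
          norm_inv_sqrt_two_smul_sq, div_div]
        norm_num

lemma lintegral_exp_norm_sq_apply_le [Fintype κ] {A : EuclideanSpace ℂ ι →L[ℂ] EuclideanSpace ℂ κ}
    (hA : ‖A‖ ≤ 1) :
    ∫⁻ z, ENNReal.ofReal (Real.exp (‖A z‖ ^ 2 / 4)) ∂complexGaussian ι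
      ≤ ENNReal.ofReal (2 ^ Fintype.card κ) := by
  rw [lintegral_exp_norm_sq_apply_eq_adjoint, ← lintegral_exp_norm_sq_complexGaussian]
  gcongr with g
  exact (ContinuousLinearMap.adjoint A).le_of_opNorm_le (by simpa using hA) g |>.trans_eq
    (one_mul _)

lemma lintegral_exp_norm_sq_starProjection_le (V : Submodule ℂ (EuclideanSpace ℂ ι)) :
    ∫⁻ z, ENNReal.ofReal (Real.exp (‖V.starProjection z‖ ^ 2 / 4)) ∂complexGaussian ι
      ≤ ENNReal.ofReal (2 ^ Module.finrank ℂ V) := by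
  let coordinates := (stdOrthonormalBasis ℂ V).repr.toContinuousLinearEquiv.toContinuousLinearMap
    ∘L V.orthogonalProjectionOnto
  have norm_coordinates (z) : ‖coordinates z‖ = ‖V.starProjection z‖ := by
    simp only [coordinates, ContinuousLinearMap.comp_apply]
    exact LinearIsometryEquiv.norm_map _ _
  have norm_coordinates_le : ‖coordinates‖ ≤ 1 :=
    coordinates.opNorm_le_bound zero_le_one fun z => by
      rw [norm_coordinates, one_mul]
      exact V.norm_starProjection_apply_le z
  simpa [norm_coordinates] using lintegral_exp_norm_sq_apply_le norm_coordinates_le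

lemma lintegral_exp_norm_sq_inner_div_le (a : EuclideanSpace ℂ ι) :
    ∫⁻ z, ENNReal.ofReal (Real.exp (‖inner ℂ a z‖ ^ 2 / (4 * ‖a‖ ^ 2))) ∂complexGaussian ι
      ≤ 2 := by
  have norm_sq_starProjection (z) :
      ‖(ℂ ∙ a).starProjection z‖ ^ 2 = ‖inner ℂ a z‖ ^ 2 / ‖a‖ ^ 2 := by
    rcases eq_or_ne a 0 with rfl | ha
    · simp
    · have := norm_ne_zero_iff.mpr ha
      rw [Submodule.starProjection_singleton, norm_smul, norm_div]
      simp only [Complex.coe_algebraMap, Complex.norm_real, norm_pow, norm_norm]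
      field_simp
  calc _ = ∫⁻ z, ENNReal.ofReal (Real.exp (‖(ℂ ∙ a).starProjection z‖ ^ 2 / 4))
          ∂complexGaussian ι := by
        simp_rw [norm_sq_starProjection, div_div, mul_comm]
    _ ≤ ENNReal.ofReal (2 ^ Module.finrank ℂ (ℂ ∙ a)) :=
        lintegral_exp_norm_sq_starProjection_le _
    _ ≤ ENNReal.ofReal (2 ^ 1) := by
        gcongr
        · norm_num
        · exact (finrank_span_le_card _).trans_eq (by simp)
    _ = 2 := by simp

lemma lintegral_exp_sum_mul_le {E : Type*} [MeasurableSpace E] {μ : Measure E} {s : Finset κ}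
    {w : κ → ℝ} (hw : ∀ i ∈ s, 0 ≤ w i) (hw_sum : ∑ i ∈ s, w i = 1) {f : κ → E → ℝ}
    (hf : ∀ i ∈ s, Measurable (f i)) {M : ℝ}
    (hM : 0 ≤ M) (hfM : ∀ i ∈ s, ∫⁻ z, ENNReal.ofReal (Real.exp (f i z)) ∂μ ≤ ENNReal.ofReal M) :
    ∫⁻ z, ENNReal.ofReal (Real.exp (∑ i ∈ s, w i * f i z)) ∂μ ≤ ENNReal.ofReal M := by
  have exp_sum_eq_prod (z : E) : ENNReal.ofReal (Real.exp (∑ i ∈ s, w i * f i z))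
      = ∏ i ∈ s, ENNReal.ofReal (Real.exp (f i z)) ^ w i := by
    rw [Real.exp_sum, ENNReal.ofReal_prod_of_nonneg fun _ _ => (Real.exp_pos _).le]
    refine Finset.prod_congr rfl fun i _ => ?_
    rw [ENNReal.ofReal_rpow_of_pos (Real.exp_pos _), ← Real.exp_mul, mul_comm]
  simp_rw [exp_sum_eq_prod]
  calc _ ≤ ∏ i ∈ s, (∫⁻ z, ENNReal.ofReal (Real.exp (f i z)) ∂μ) ^ w i :=
        ENNReal.lintegral_prod_norm_pow_le s (fun i hi => by have := hf i hi; fun_prop) hw_sum hw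
    _ ≤ ∏ i ∈ s, ENNReal.ofReal M ^ w i := by
        gcongr with i hi
        · exact hw i hi
        · exact hfM i hi
    _ = ENNReal.ofReal (∏ i ∈ s, M ^ w i) := by
        rw [ENNReal.ofReal_prod_of_nonneg fun _ _ => by positivity]
        exact Finset.prod_congr rfl fun i hi => ENNReal.ofReal_rpow_of_nonneg hM (hw i hi)
    _ = ENNReal.ofReal M := by rw [← Real.rpow_sum_of_nonneg hM hw, hw_sum, Real.rpow_one]

lemma sum_norm_sq_inner_le (s : Finset κ) (c : κ → EuclideanSpace ℂ ι)
    (z : EuclideanSpace ℂ ι) :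
    ∑ i ∈ s, ‖inner ℂ (c i) z‖ ^ 2 ≤ (∑ i ∈ s, ‖c i‖ ^ 2) * ‖z‖ ^ 2 := by
  rw [Finset.sum_mul]
  gcongr with i
  rw [← mul_pow]
  gcongr
  exact norm_inner_le_norm _ _

lemma lintegral_exp_sum_norm_sq_inner_div_le {s : Finset κ} {c : κ → EuclideanSpace ℂ ι} {V : ℝ}
    (hc : ∑ i ∈ s, ‖c i‖ ^ 2 ≤ V) :
    ∫⁻ z, ENNReal.ofReal (Real.exp ((∑ i ∈ s, ‖inner ℂ (c i) z‖ ^ 2) / (4 * V)))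
      ∂complexGaussian ι ≤ 2 := by
  set W := ∑ i ∈ s, ‖c i‖ ^ 2
  have W_nonneg : 0 ≤ W := by positivity
  rcases W_nonneg.eq_or_lt with W_zero | W_pos
  · have sum_zero (z) : ∑ i ∈ s, ‖inner ℂ (c i) z‖ ^ 2 = 0 :=
      le_antisymm ((sum_norm_sq_inner_le s c z).trans_eq (by simp [W, ← W_zero]))
        (by positivity)
    simp [sum_zero]
  have weighted_sum (z) : (∑ i ∈ s, ‖inner ℂ (c i) z‖ ^ 2) / (4 * W)
      = ∑ i ∈ s, ‖c i‖ ^ 2 / W * (‖inner ℂ (c i) z‖ ^ 2 / (4 * ‖c i‖ ^ 2)) := by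
    rw [Finset.sum_div]
    refine Finset.sum_congr rfl fun i _ => ?_
    rcases eq_or_ne (c i) 0 with hc | hc
    · simp [hc]
    · have := norm_ne_zero_iff.mpr hc
      field_simp
  calc _ ≤ ∫⁻ z, ENNReal.ofReal (Real.exp ((∑ i ∈ s, ‖inner ℂ (c i) z‖ ^ 2) / (4 * W)))
          ∂complexGaussian ι := by gcongr
    _ ≤ ENNReal.ofReal 2 := by
        simp_rw [weighted_sum]
        exact lintegral_exp_sum_mul_le (fun i _ => by positivity)
          (by rw [← Finset.sum_div, div_self W_pos.ne']) (fun i _ => by fun_prop) zero_le_two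
          fun i _ => by simpa using lintegral_exp_norm_sq_inner_div_le (c i)
    _ = 2 := by simp

end ExponentialMoments

section Tails

variable {ι κ : Type*} [Fintype ι]

lemma measure_log_lt_le_of_lintegral_exp_le {E : Type*} [MeasurableSpace E] {μ : Measure E}
    {f : E → ℝ} (hf : Measurable f) {M δ : ℝ} (hM : 0 < M) (hδ : 0 < δ)
    (h : ∫⁻ z, ENNReal.ofReal (Real.exp (f z)) ∂μ ≤ ENNReal.ofReal M) :
    μ {z | Real.log (M / δ) < f z} ≤ ENNReal.ofReal δ := by
  calc μ {z | Real.log (M / δ) < f z}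
      ≤ μ {z | ENNReal.ofReal (M / δ) ≤ ENNReal.ofReal (Real.exp (f z))} := by
        refine measure_mono fun z (hz : Real.log (M / δ) < f z) => ENNReal.ofReal_le_ofReal ?_
        exact (Real.log_le_iff_le_exp (div_pos hM hδ)).mp hz.le
    _ ≤ (∫⁻ z, ENNReal.ofReal (Real.exp (f z)) ∂μ) / ENNReal.ofReal (M / δ) :=
        meas_ge_le_lintegral_div (by fun_prop) (by simpa using div_pos hM hδ)
          ENNReal.ofReal_ne_top
    _ ≤ ENNReal.ofReal M / ENNReal.ofReal (M / δ) := by gcongr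
    _ = ENNReal.ofReal δ := by
        rw [← ENNReal.ofReal_div_of_pos (div_pos hM hδ), div_div_cancel₀ hM.ne']

lemma measure_sum_norm_sq_inner_gt_le {s : Finset κ} {c : κ → EuclideanSpace ℂ ι} {V δ : ℝ}
    (hc : ∑ i ∈ s, ‖c i‖ ^ 2 ≤ V) (hδ : 0 < δ) :
    complexGaussian ι {z | 4 * V * Real.log (2 / δ) < ∑ i ∈ s, ‖inner ℂ (c i) z‖ ^ 2}
      ≤ ENNReal.ofReal δ := by
  have V_nonneg : 0 ≤ V := le_trans (by positivity) hc
  rcases V_nonneg.eq_or_lt with rfl | V_pos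
  · have sum_le_zero (z) : ∑ i ∈ s, ‖inner ℂ (c i) z‖ ^ 2 ≤ 0 :=
      (sum_norm_sq_inner_le s c z).trans (mul_nonpos_of_nonpos_of_nonneg hc (sq_nonneg _))
    simp [(sum_le_zero _).not_gt]
  · refine (measure_mono fun z hz => ?_).trans (measure_log_lt_le_of_lintegral_exp_le
      (f := fun z => (∑ i ∈ s, ‖inner ℂ (c i) z‖ ^ 2) / (4 * V)) (by fun_prop) two_pos hδ
      (by simpa using lintegral_exp_sum_norm_sq_inner_div_le hc))
    rw [Set.mem_ofPred_eq, lt_div_iff₀ (by positivity), mul_comm]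
    exact hz

lemma measure_norm_sq_starProjection_gt_le (V : Submodule ℂ (EuclideanSpace ℂ ι)) {δ : ℝ}
    (hδ : 0 < δ) :
    complexGaussian ι {z | 4 * Real.log (2 ^ Module.finrank ℂ V / δ) < ‖V.starProjection z‖ ^ 2}
      ≤ ENNReal.ofReal δ := by
  refine (measure_mono fun z hz => ?_).trans (measure_log_lt_le_of_lintegral_exp_le
    (by fun_prop) (by positivity) hδ (lintegral_exp_norm_sq_starProjection_le V))
  rw [Set.mem_ofPred_eq, lt_div_iff₀ four_pos, mul_comm]
  exact hz

end Tails

section QuadraticForms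

open ContinuousLinearMap (adjoint)

variable {ι : Type*} [Fintype ι]

/-- The squared Hilbert–Schmidt norm of an operator, read off the standard basis; it controls the
fluctuations of the quadratic form of the operator in a Gaussian vector. -/
noncomputable def hilbertSchmidtSq (K : EuclideanSpace ℂ ι →L[ℂ] EuclideanSpace ℂ ι) : ℝ :=
  ∑ i, ‖K (EuclideanSpace.basisFun ι ℂ i)‖ ^ 2

variable {K : EuclideanSpace ℂ ι →L[ℂ] EuclideanSpace ℂ ι}

lemma hilbertSchmidtSq_adjoint (K : EuclideanSpace ℂ ι →L[ℂ] EuclideanSpace ℂ ι) :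
    hilbertSchmidtSq (adjoint K) = hilbertSchmidtSq K := by
  simp_rw [hilbertSchmidtSq, ← (EuclideanSpace.basisFun ι ℂ).sum_sq_norm_inner_right (adjoint K _),
    ← (EuclideanSpace.basisFun ι ℂ).sum_sq_norm_inner_left (K _),
    ContinuousLinearMap.adjoint_inner_right]
  exact Finset.sum_comm

lemma hilbertSchmidtSq_add_le (K L : EuclideanSpace ℂ ι →L[ℂ] EuclideanSpace ℂ ι) :
    hilbertSchmidtSq (K + L) ≤ 2 * (hilbertSchmidtSq K + hilbertSchmidtSq L) := by
  simp_rw [hilbertSchmidtSq, ← Finset.sum_add_distrib, Finset.mul_sum]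
  gcongr with i
  exact (pow_le_pow_left₀ (norm_nonneg _) (norm_add_le _ _) 2).trans add_sq_le

lemma hilbertSchmidtSq_smul (c : ℂ) (K : EuclideanSpace ℂ ι →L[ℂ] EuclideanSpace ℂ ι) :
    hilbertSchmidtSq (c • K) = ‖c‖ ^ 2 * hilbertSchmidtSq K := by
  simp [hilbertSchmidtSq, norm_smul, mul_pow, Finset.mul_sum]

lemma norm_sq_apply_eq_sum (hK : adjoint K = K) (z : EuclideanSpace ℂ ι) :
    ‖K z‖ ^ 2 = ∑ i, ‖inner ℂ (K (EuclideanSpace.basisFun ι ℂ i)) z‖ ^ 2 := by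
  simp_rw [← (EuclideanSpace.basisFun ι ℂ).sum_sq_norm_inner_right (K z),
    ← ContinuousLinearMap.adjoint_inner_left, hK]

lemma inner_apply_eq_sum (K : EuclideanSpace ℂ ι →L[ℂ] EuclideanSpace ℂ ι)
    (z : EuclideanSpace ℂ ι) :
    inner ℂ z (K z) = ∑ i, ∑ j, (conj (z i) * z j)
      * inner ℂ (EuclideanSpace.basisFun ι ℂ i) (K (EuclideanSpace.basisFun ι ℂ j)) := by
  have expansion : z = ∑ i, z i • EuclideanSpace.basisFun ι ℂ i := by
    simpa using ((EuclideanSpace.basisFun ι ℂ).sum_repr z).symm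
  conv_lhs => rw [expansion]
  simp_rw [map_sum, map_smul, sum_inner, inner_sum, inner_smul_left, inner_smul_right]
  refine Finset.sum_congr rfl fun i _ => Finset.sum_congr rfl fun j _ => ?_
  ring

lemma integrable_inner_apply (K : EuclideanSpace ℂ ι →L[ℂ] EuclideanSpace ℂ ι) :
    Integrable (fun z => inner ℂ z (K z)) (complexGaussian ι) := by
  simp_rw [inner_apply_eq_sum]
  exact integrable_finsetSum _ fun i _ => integrable_finsetSum _ fun j _ =>
    (integrable_conj_mul_coord_complexGaussian i j).mul_const _

lemma integral_inner_apply (K : EuclideanSpace ℂ ι →L[ℂ] EuclideanSpace ℂ ι) :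
    ∫ z, inner ℂ z (K z) ∂complexGaussian ι = 2 * LinearMap.trace ℂ _ K.toLinearMap := by
  classical
  simp_rw [inner_apply_eq_sum]
  rw [integral_finsetSum _ fun i _ => integrable_finsetSum _ fun j _ =>
      (integrable_conj_mul_coord_complexGaussian i j).mul_const _,
    LinearMap.trace_eq_sum_inner _ (EuclideanSpace.basisFun ι ℂ), Finset.mul_sum]
  refine Finset.sum_congr rfl fun i _ => ?_
  rw [integral_finsetSum _ fun j _ =>
    (integrable_conj_mul_coord_complexGaussian i j).mul_const _]
  simp_rw [integral_mul_const, integral_conj_mul_coord_complexGaussian]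
  simp

lemma integral_re_inner_apply (K : EuclideanSpace ℂ ι →L[ℂ] EuclideanSpace ℂ ι) :
    ∫ z, (inner ℂ z (K z)).re ∂complexGaussian ι
      = 2 * (LinearMap.trace ℂ _ K.toLinearMap).re := by
  refine (integral_re (integrable_inner_apply K)).trans ?_
  simp [integral_inner_apply]

lemma integral_norm_sq_add_inner (b : ℂ) (a : EuclideanSpace ℂ ι) :
    ∫ z, ‖b + inner ℂ a z‖ ^ 2 ∂complexGaussian ι = ‖b‖ ^ 2 + 2 * ‖a‖ ^ 2 := by
  let L : EuclideanSpace ℂ ι →L[ℝ] ℝ :=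
    Complex.reCLM ∘L (innerSL ℂ (b • a)).restrictScalars ℝ
  let R := InnerProductSpace.rankOne ℂ a a
  have expand (z) : ‖b + inner ℂ a z‖ ^ 2 = ‖b‖ ^ 2 + 2 * L z + (inner ℂ z (R z)).re := by
    have inner_rankOne : (inner ℂ z (R z)).re = ‖inner ℂ a z‖ ^ 2 := by
      rw [InnerProductSpace.rankOne_apply, inner_smul_right, ← inner_conj_symm z a,
        Complex.mul_conj, Complex.ofReal_re, Complex.normSq_eq_norm_sq]
    rw [norm_add_sq (𝕜 := ℂ), inner_rankOne]
    simp [L, mul_comm]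
  have integrable_L : Integrable (fun z => 2 * L z) (complexGaussian ι) :=
    (L.integrable_comp IsGaussian.integrable_id).const_mul 2
  have integrable_R : Integrable (fun z => (inner ℂ z (R z)).re) (complexGaussian ι) :=
    (integrable_inner_apply R).re
  have integrable_affine : Integrable (fun z => ‖b‖ ^ 2 + 2 * L z) (complexGaussian ι) :=
    (integrable_const _).add integrable_L
  simp_rw [expand]
  rw [integral_add integrable_affine integrable_R, integral_add (integrable_const _) integrable_L,
    integral_const_mul,
    integral_clm_complexGaussian, integral_re_inner_apply, InnerProductSpace.trace_rankOne,
    inner_self_eq_norm_sq_to_K]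
  simp [← Complex.ofReal_pow]

lemma ofReal_exp_integral_le_lintegral {E : Type*} [MeasurableSpace E] {μ : Measure E}
    [IsProbabilityMeasure μ] {f : E → ℝ} (hf : Integrable f μ) :
    ENNReal.ofReal (Real.exp (∫ z, f z ∂μ)) ≤ ∫⁻ z, ENNReal.ofReal (Real.exp (f z)) ∂μ := by
  by_cases integrable_exp : Integrable (fun z => Real.exp (f z)) μ
  · rw [← ofReal_integral_eq_lintegral_ofReal integrable_exp
      (ae_of_all _ fun _ => (Real.exp_pos _).le)]
    exact ENNReal.ofReal_le_ofReal (convexOn_exp.map_integral_le Real.continuous_exp.continuousOn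
      isClosed_univ (ae_of_all _ fun _ => Set.mem_univ _) hf integrable_exp)
  · have lintegral_top := mt (lintegral_ofReal_ne_top_iff_integrable
      (Real.continuous_exp.comp_aestronglyMeasurable hf.aestronglyMeasurable)
      (ae_of_all _ fun _ => (Real.exp_pos _).le)).mp integrable_exp
    exact le_top.trans_eq (not_not.mp lintegral_top).symm

lemma lintegral_exp_sub_integral_le {E : Type*} [MeasurableSpace E] {μ : Measure E}
    [IsProbabilityMeasure μ] {f : E → ℝ} (hf : Integrable f μ) :
    ∫⁻ z, ENNReal.ofReal (Real.exp (f z - ∫ w, f w ∂μ)) ∂μ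
      ≤ ∫⁻ z, ∫⁻ w, ENNReal.ofReal (Real.exp (f z - f w)) ∂μ ∂μ := by
  gcongr with z
  simpa [integral_sub (integrable_const (f z)) hf] using
    ofReal_exp_integral_le_lintegral ((integrable_const (f z)).sub hf)

lemma re_inner_apply_rotation (K : EuclideanSpace ℂ ι →L[ℂ] EuclideanSpace ℂ ι)
    (u v : EuclideanSpace ℂ ι) {r : ℝ} (hr : r ^ 2 = 1 / 2) :
    (inner ℂ (r • u + r • v) (K (r • u + r • v))).re
      - (inner ℂ (-r • u + r • v) (K (-r • u + r • v))).re
      = (inner ℂ ((K + adjoint K) u) v).re := by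
  have re_inner_swap : (inner ℂ v (K u)).re = (inner ℂ (K u) v).re := by
    rw [← inner_conj_symm, Complex.conj_re]
  simp only [← Complex.coe_smul, map_add, map_smul, inner_add_left, inner_add_right,
    inner_smul_left, inner_smul_right, Complex.conj_ofReal, Complex.add_re,
    Complex.re_ofReal_mul, re_inner_swap, add_apply, ContinuousLinearMap.adjoint_inner_left]
  linear_combination (2 * ((inner ℂ (K u) v).re + (inner ℂ u (K v)).re)) * hr

-- Rotating a pair of independent copies by `π / 4` turns the difference of their quadratic forms
-- into a bilinear form, which is Gaussian given one of the copies.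
lemma lintegral_exp_quadratic_sub (K : EuclideanSpace ℂ ι →L[ℂ] EuclideanSpace ℂ ι) :
    ∫⁻ z, ∫⁻ w, ENNReal.ofReal (Real.exp ((inner ℂ z (K z)).re - (inner ℂ w (K w)).re))
        ∂complexGaussian ι ∂complexGaussian ι
      = ∫⁻ u, ENNReal.ofReal (Real.exp (‖(K + adjoint K) u‖ ^ 2 / 2)) ∂complexGaussian ι := by
  set γ := complexGaussian ι
  let F : EuclideanSpace ℂ ι × EuclideanSpace ℂ ι → ℝ≥0∞ :=
    fun p => ENNReal.ofReal (Real.exp ((inner ℂ p.1 (K p.1)).re - (inner ℂ p.2 (K p.2)).re))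
  have measurable_F : Measurable F :=
    ENNReal.measurable_ofReal.comp (Continuous.measurable (by fun_prop))
  have sq_half_sqrt_two : (√2 / 2) ^ 2 = 1 / 2 := by
    rw [div_pow, Real.sq_sqrt zero_le_two]; norm_num
  have rotation := IsGaussian.map_rotation_eq_self (μ := γ) integral_id_complexGaussian
    (Real.pi / 4)
  calc _ = ∫⁻ p, F p ∂γ.prod γ := (lintegral_prod _ measurable_F.aemeasurable).symm
    _ = ∫⁻ u, ∫⁻ v, ENNReal.ofReal (Real.exp (inner ℂ ((K + adjoint K) u) v).re) ∂γ ∂γ := by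
        rw [← rotation, lintegral_map measurable_F (by fun_prop), lintegral_prod _ (by fun_prop)]
        refine lintegral_congr fun u => lintegral_congr fun v => ?_
        simp only [F, ContinuousLinearMap.rotation_apply, Real.cos_pi_div_four,
          Real.sin_pi_div_four]
        rw [re_inner_apply_rotation K u v sq_half_sqrt_two]
    _ = _ := lintegral_congr fun u => lintegral_exp_re_inner_complexGaussian _

lemma lintegral_exp_re_quadratic_le (hK : hilbertSchmidtSq K ≤ 1 / 8) :
    ∫⁻ z, ENNReal.ofReal (Real.exp ((inner ℂ z (K z)).re
      - 2 * (LinearMap.trace ℂ _ K.toLinearMap).re)) ∂complexGaussian ι ≤ 2 := by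
  have adjoint_eq : adjoint (K + adjoint K) = K + adjoint K := by
    rw [map_add, ContinuousLinearMap.adjoint_adjoint, add_comm]
  have hilbertSchmidtSq_le : hilbertSchmidtSq (K + adjoint K) ≤ 1 / 2 := by
    linarith [hilbertSchmidtSq_add_le K (adjoint K), hilbertSchmidtSq_adjoint K]
  calc _ ≤ ∫⁻ u, ENNReal.ofReal (Real.exp (‖(K + adjoint K) u‖ ^ 2 / 2)) ∂complexGaussian ι := by
        rw [← integral_re_inner_apply, ← lintegral_exp_quadratic_sub]
        exact lintegral_exp_sub_integral_le (integrable_inner_apply K).re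
    _ ≤ 2 := by
        simp_rw [norm_sq_apply_eq_sum adjoint_eq]
        convert lintegral_exp_sum_norm_sq_inner_div_le hilbertSchmidtSq_le using 5
        norm_num

lemma measure_re_quadratic_gt_le {V δ : ℝ} (hV : 0 < V) (hK : hilbertSchmidtSq K ≤ V)
    (hδ : 0 < δ) :
    complexGaussian ι {z | √(8 * V) * Real.log (2 / δ) < (inner ℂ z (K z)).re
      - 2 * (LinearMap.trace ℂ _ K.toLinearMap).re} ≤ ENNReal.ofReal δ := by
  set r := √(8 * V)
  have r_pos : 0 < r := Real.sqrt_pos.mpr (by positivity)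
  have scaled : hilbertSchmidtSq (((r⁻¹ : ℝ) : ℂ) • K) ≤ 1 / 8 := by
    rw [hilbertSchmidtSq_smul, Complex.norm_real, Real.norm_eq_abs, sq_abs, inv_pow,
      Real.sq_sqrt (by positivity), inv_mul_le_iff₀ (by positivity)]
    linarith
  have tail := measure_log_lt_le_of_lintegral_exp_le (by fun_prop) two_pos hδ
    ((lintegral_exp_re_quadratic_le scaled).trans_eq (by simp))
  simp only [smul_apply, inner_smul_right, ContinuousLinearMap.toLinearMap_smul, map_smul,
    smul_eq_mul, Complex.re_ofReal_mul] at tail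
  refine (measure_mono fun z hz => ?_).trans tail
  have : Real.log (2 / δ) < r⁻¹ * ((inner ℂ z (K z)).re
      - 2 * (LinearMap.trace ℂ _ K.toLinearMap).re) := (lt_inv_mul_iff₀ r_pos).mpr hz
  rw [Set.mem_ofPred_eq]
  linarith

lemma norm_le_two_mul_of_unit_re_le {w : ℂ} {B : ℝ}
    (h : ∀ c ∈ ({1, -1, Complex.I, -Complex.I} : Finset ℂ), (c * w).re ≤ B) : ‖w‖ ≤ 2 * B := by
  simp only [Finset.mem_insert, Finset.mem_singleton, forall_eq_or_imp, forall_eq, one_mul,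
    neg_mul, Complex.neg_re, Complex.I_mul_re, neg_neg] at h
  have re_le : |w.re| ≤ B := abs_le.mpr ⟨by linarith, by linarith⟩
  have im_le : |w.im| ≤ B := abs_le.mpr ⟨by linarith, by linarith⟩
  linarith [Complex.norm_le_abs_re_add_abs_im w]

lemma measure_norm_quadratic_gt_le {V T δ : ℝ} (hV : 0 < V) (hK : hilbertSchmidtSq K ≤ V)
    (hT : ‖LinearMap.trace ℂ _ K.toLinearMap‖ ≤ T) (hδ : 0 < δ) :
    complexGaussian ι {z | 2 * (√(8 * V) * Real.log (2 / δ) + 2 * T) < ‖inner ℂ z (K z)‖}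
      ≤ 4 * ENNReal.ofReal δ := by
  let units : Finset ℂ := {1, -1, Complex.I, -Complex.I}
  have norm_unit : ∀ c ∈ units, ‖c‖ = 1 := by simp [units]
  let bad (c : ℂ) : Set (EuclideanSpace ℂ ι) :=
    {z | √(8 * V) * Real.log (2 / δ) < (inner ℂ z ((c • K) z)).re
      - 2 * (LinearMap.trace ℂ _ (c • K).toLinearMap).re}
  have measure_bad_le : ∀ c ∈ units, complexGaussian ι (bad c) ≤ ENNReal.ofReal δ := fun c hc =>
    measure_re_quadratic_gt_le hV (by simpa [hilbertSchmidtSq_smul, norm_unit c hc] using hK) hδ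
  have subset_bad : {z | 2 * (√(8 * V) * Real.log (2 / δ) + 2 * T) < ‖inner ℂ z (K z)‖}
      ⊆ ⋃ c ∈ units, bad c := by
    intro z hz
    by_contra not_bad
    simp only [Set.mem_iUnion, not_exists] at not_bad
    refine (norm_le_two_mul_of_unit_re_le fun c hc => ?_).not_gt hz
    have re_le : (inner ℂ z ((c • K) z)).re - 2 * (LinearMap.trace ℂ _ (c • K).toLinearMap).re
        ≤ √(8 * V) * Real.log (2 / δ) := not_lt.mp (not_bad c hc)
    simp only [smul_apply, inner_smul_right, ContinuousLinearMap.toLinearMap_smul, map_smul,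
      smul_eq_mul] at re_le
    have trace_le := Complex.re_le_norm (c * LinearMap.trace ℂ _ K.toLinearMap)
    rw [norm_mul, norm_unit c hc, one_mul] at trace_le
    linarith
  calc _ ≤ complexGaussian ι (⋃ c ∈ units, bad c) := measure_mono subset_bad
    _ ≤ ∑ c ∈ units, complexGaussian ι (bad c) := measure_biUnion_finset_le _ _
    _ ≤ units.card • ENNReal.ofReal δ := Finset.sum_le_card_nsmul _ _ _ measure_bad_le
    _ ≤ 4 * ENNReal.ofReal δ := by
        rw [nsmul_eq_mul]
        gcongr
        exact_mod_cast Finset.card_le_four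

end QuadraticForms

section ProjectedQuadraticForms

open ContinuousLinearMap (adjoint adjoint_inner_left)

variable {ι : Type*} [Fintype ι]

lemma hilbertSchmidtSq_starProjection (V : Submodule ℂ (EuclideanSpace ℂ ι)) :
    hilbertSchmidtSq V.starProjection = Module.finrank ℂ V := by
  have isProj : LinearMap.IsProj V V.starProjection.toLinearMap :=
    ⟨V.starProjection_apply_mem, fun _ => V.starProjection_eq_self_iff.2⟩
  have trace_eq := isProj.trace
  rw [LinearMap.trace_eq_sum_inner _ (EuclideanSpace.basisFun ι ℂ)] at trace_eq
  apply Complex.ofReal_injective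
  rw [hilbertSchmidtSq, Complex.ofReal_natCast, ← trace_eq]
  push_cast
  refine Finset.sum_congr rfl fun i _ => ?_
  refine (inner_self_eq_norm_sq_to_K (𝕜 := ℂ) (V.starProjection _)).symm.trans ?_
  rw [Submodule.inner_starProjection_left_eq_right,
    V.starProjection_eq_self_iff.2 (V.starProjection_apply_mem _)]

lemma norm_trace_comp_le (K L : EuclideanSpace ℂ ι →L[ℂ] EuclideanSpace ℂ ι) :
    ‖LinearMap.trace ℂ _ (K ∘L L).toLinearMap‖
      ≤ √(hilbertSchmidtSq K) * √(hilbertSchmidtSq L) := by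
  set e := EuclideanSpace.basisFun ι ℂ
  have norm_inner_le (i : ι) : ‖inner ℂ (e i) (K (L (e i)))‖ ≤ ‖adjoint K (e i)‖ * ‖L (e i)‖ := by
    rw [← adjoint_inner_left]
    exact norm_inner_le_norm _ _
  rw [LinearMap.trace_eq_sum_inner _ e, ← hilbertSchmidtSq_adjoint K]
  exact (norm_sum_le _ _).trans <| (Finset.sum_le_sum fun i _ => norm_inner_le i).trans <|
    Real.sum_mul_le_sqrt_mul_sqrt _ _ _

lemma hilbertSchmidtSq_starProjection_comp_le (V : Submodule ℂ (EuclideanSpace ℂ ι))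
    (M : EuclideanSpace ℂ ι →L[ℂ] EuclideanSpace ℂ ι) :
    hilbertSchmidtSq (V.starProjection ∘L M) ≤ hilbertSchmidtSq M := by
  simp only [hilbertSchmidtSq, ContinuousLinearMap.comp_apply]
  gcongr
  exact V.norm_starProjection_apply_le _

lemma norm_trace_starProjection_orthogonal_comp_le (V : Submodule ℂ (EuclideanSpace ℂ ι))
    (M : EuclideanSpace ℂ ι →L[ℂ] EuclideanSpace ℂ ι) :
    ‖LinearMap.trace ℂ _ (Vᗮ.starProjection ∘L M).toLinearMap‖
      ≤ ‖LinearMap.trace ℂ _ M.toLinearMap‖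
        + √(Module.finrank ℂ V) * √(hilbertSchmidtSq M) := by
  have decomposition : (Vᗮ.starProjection ∘L M).toLinearMap
      = M.toLinearMap - (V.starProjection ∘L M).toLinearMap := by
    ext1 z
    simp
  rw [decomposition, map_sub]
  refine (norm_sub_le _ _).trans ?_
  grw [norm_trace_comp_le, hilbertSchmidtSq_starProjection]

end ProjectedQuadraticForms

section Convolution

variable {a b c d : ℤ} {φ ψ : Signal}

lemma SupportedOn.mono (h : SupportedOn a b ψ) (hca : c ≤ a) (hbd : b ≤ d) :
    SupportedOn c d ψ :=
  fun t ht => h t fun h_mem => ht (Set.Icc_subset_Icc hca hbd h_mem)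

lemma SupportedOn.apply_eq_zero (h : SupportedOn a b ψ) {τ : ℤ} (hτ : τ ∉ Finset.Icc a b) :
    ψ τ = 0 :=
  h τ (by simpa using hτ)

lemma SupportedOn.apply_sub_eq_zero (h : SupportedOn a b ψ) {t : ℤ} {U : Finset ℤ}
    (hU : Finset.Icc (t - b) (t - a) ⊆ U) : ∀ u ∉ U, ψ (t - u) = 0 := by
  intro u hu
  have := mt (@hU u) hu
  refine h _ fun hτ => this ?_
  rw [Set.mem_Icc] at hτ
  rw [Finset.mem_Icc]
  lia

lemma SupportedOn.conv_apply (h : SupportedOn a b ψ) (v : Signal) (t : ℤ) :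
    conv ψ v t = ∑ τ ∈ Finset.Icc a b, ψ τ * v (t - τ) :=
  tsum_eq_sum fun τ hτ => by rw [h.apply_eq_zero hτ, zero_mul]

lemma conv_eq_tsum_sub (ψ v : Signal) (t : ℤ) : conv ψ v t = ∑' u : ℤ, ψ (t - u) * v u := by
  rw [conv, ← (Equiv.subLeft t).tsum_eq]
  simp only [Equiv.subLeft_apply, sub_sub_cancel]

lemma conv_eq_sum_sub (v : Signal) {t : ℤ} {U : Finset ℤ} (hU : ∀ u ∉ U, ψ (t - u) = 0) :
    conv ψ v t = ∑ u ∈ U, ψ (t - u) * v u := by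
  rw [conv_eq_tsum_sub]
  exact tsum_eq_sum fun u hu => by rw [hU u hu, zero_mul]

lemma SupportedOn.conv_add (h : SupportedOn a b ψ) (u v : Signal) :
    conv ψ (u + v) = conv ψ u + conv ψ v := by
  ext t
  simp only [h.conv_apply, Pi.add_apply, mul_add, Finset.sum_add_distrib]

lemma SupportedOn.conv_smul (h : SupportedOn a b ψ) (r : ℂ) (v : Signal) :
    conv ψ (r • v) = r • conv ψ v := by
  ext t
  simp only [h.conv_apply, Pi.smul_apply, smul_eq_mul, Finset.mul_sum, mul_left_comm]

lemma SupportedOn.conv_sub (h : SupportedOn a b ψ) (u v : Signal) :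
    conv ψ (u - v) = conv ψ u - conv ψ v := by
  ext t
  simp only [h.conv_apply, Pi.sub_apply, mul_sub, Finset.sum_sub_distrib]

lemma SupportedOn.conv_observe (h : SupportedOn a b ψ) (x z : Signal) (σ : ℝ) :
    conv ψ (observe x σ z) = conv ψ x + (σ : ℂ) • conv ψ z := by
  rw [← h.conv_smul, ← h.conv_add]
  rfl

lemma conv_sum_smul {κ : Type*} (s : Finset κ) (r : κ → ℂ) {f : κ → Signal}
    (h : ∀ j, SupportedOn a b (f j)) (v : Signal) :
    conv (∑ j ∈ s, r j • f j) v = ∑ j ∈ s, r j • conv (f j) v := by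
  ext t
  have supportedOn_sum : SupportedOn a b (∑ j ∈ s, r j • f j) := fun t ht => by
    simp [h _ t ht]
  simp only [supportedOn_sum.conv_apply, (h _).conv_apply, Finset.sum_apply, Pi.smul_apply,
    smul_eq_mul, Finset.sum_mul, Finset.mul_sum, mul_assoc]
  exact Finset.sum_comm

lemma SupportedOn.conv_left_comm (hφ : SupportedOn a b φ) (hψ : SupportedOn c d ψ)
    (v : Signal) : conv φ (conv ψ v) = conv ψ (conv φ v) := by
  ext t
  simp only [hφ.conv_apply, hψ.conv_apply, Finset.mul_sum]
  rw [Finset.sum_comm]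
  simp only [mul_left_comm, sub_right_comm]

lemma SupportedOn.supportedOn_conv (hφ : SupportedOn a b φ) (hψ : SupportedOn c d ψ) :
    SupportedOn (a + c) (b + d) (conv φ ψ) := by
  intro t ht
  rw [hφ.conv_apply]
  refine Finset.sum_eq_zero fun τ hτ => ?_
  rw [hψ (t - τ), mul_zero]
  rw [Finset.mem_Icc] at hτ
  rw [Set.mem_Icc] at ht ⊢
  lia

lemma SupportedOn.conv_assoc (hφ : SupportedOn a b φ) (hψ : SupportedOn c d ψ) (v : Signal) :
    conv (conv φ ψ) v = conv φ (conv ψ v) := by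
  ext t
  have inner_sum (τ : ℤ) (hτ : τ ∈ Finset.Icc a b) : conv ψ v (t - τ)
      = ∑ u ∈ Finset.Icc (t - (b + d)) (t - (a + c)), ψ (t - τ - u) * v u := by
    rw [Finset.mem_Icc] at hτ
    exact conv_eq_sum_sub v (hψ.apply_sub_eq_zero (Finset.Icc_subset_Icc (by lia) (by lia)))
  rw [conv_eq_sum_sub v ((hφ.supportedOn_conv hψ).apply_sub_eq_zero Finset.Subset.rfl),
    hφ.conv_apply]
  simp_rw [hφ.conv_apply ψ, Finset.sum_mul]
  rw [Finset.sum_comm]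
  refine Finset.sum_congr rfl fun τ hτ => ?_
  rw [inner_sum τ hτ, Finset.mul_sum]
  simp only [mul_assoc, sub_right_comm]

end Convolution

section Energy

variable {a b : ℤ} {ψ : Signal}

/-- The squared `ℓ₂`-norm of a sequence, meaningful when the squares are summable. -/
noncomputable def energy (u : Signal) : ℝ := ∑' t, ‖u t‖ ^ 2

lemma energy_nonneg (u : Signal) : 0 ≤ energy u := tsum_nonneg fun _ => by positivity

lemma SupportedOn.energy_eq_sum (h : SupportedOn a b ψ) :
    energy ψ = ∑ τ ∈ Finset.Icc a b, ‖ψ τ‖ ^ 2 :=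
  tsum_eq_sum fun τ hτ => by simp [h.apply_eq_zero hτ]

lemma SupportedOn.energy_eq_sum_sub (h : SupportedOn a b ψ) {t : ℤ} {U : Finset ℤ}
    (hU : Finset.Icc (t - b) (t - a) ⊆ U) : energy ψ = ∑ u ∈ U, ‖ψ (t - u)‖ ^ 2 := by
  rw [energy, ← (Equiv.subLeft t).tsum_eq]
  exact tsum_eq_sum fun u hu => by simp [h.apply_sub_eq_zero hU u hu]

lemma SupportedOn.sum_norm_sq_sub_le_energy (h : SupportedOn a b ψ) (t : ℤ) (U : Finset ℤ) :
    ∑ u ∈ U, ‖ψ (t - u)‖ ^ 2 ≤ energy ψ := by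
  rw [h.energy_eq_sum_sub (Finset.subset_union_left (s₂ := U))]
  gcongr
  exact Finset.subset_union_right

lemma SupportedOn.norm_conv_sq_le (h : SupportedOn a b ψ) (v : Signal) {t : ℤ} {U : Finset ℤ}
    (hU : Finset.Icc (t - b) (t - a) ⊆ U) :
    ‖conv ψ v t‖ ^ 2 ≤ energy ψ * ∑ u ∈ U, ‖v u‖ ^ 2 := by
  rw [conv_eq_sum_sub v (h.apply_sub_eq_zero hU), h.energy_eq_sum_sub hU]
  refine (pow_le_pow_left₀ (norm_nonneg _) (norm_sum_le _ _) 2).trans ?_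
  simp_rw [norm_mul]
  exact Finset.sum_mul_sq_le_sq_mul_sq _ _ _

lemma SupportedOn.norm_conv_sq_le_of_forall (h : SupportedOn a b ψ) {v : Signal} {t : ℤ} {B : ℝ}
    (hv : ∀ u ∈ Finset.Icc (t - b) (t - a), ‖v u‖ ^ 2 ≤ B) :
    ‖conv ψ v t‖ ^ 2 ≤ energy ψ * ((b - a + 1).toNat * B) := by
  refine (h.norm_conv_sq_le v Finset.Subset.rfl).trans ?_
  gcongr
  · exact energy_nonneg ψ
  refine (Finset.sum_le_card_nsmul _ _ _ hv).trans_eq ?_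
  rw [Int.card_Icc, nsmul_eq_mul]
  congr 3
  ring

end Energy

section Fourier

variable {n k : ℕ} {φ ψ : Signal}

/-- The character `t ↦ exp (2 π i j t / (n + 1))` of `ℤ`, which occurs in `dft`. -/
noncomputable def character (n j : ℕ) (t : ℤ) : ℂ :=
  ZMod.stdAddChar ((j * t : ℤ) : ZMod (n + 1))

lemma character_zero (j : ℕ) : character n j 0 = 1 := by simp [character]

lemma character_add (j : ℕ) (s t : ℤ) :
    character n j (s + t) = character n j s * character n j t := by
  rw [character, mul_add, Int.cast_add, AddChar.map_add_eq_mul, character, character]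

lemma norm_character (j : ℕ) (t : ℤ) : ‖character n j t‖ = 1 :=
  AddChar.norm_apply _ _

lemma conj_character (j : ℕ) (t : ℤ) : conj (character n j t) = character n j (-t) := by
  rw [character, character, mul_neg, Int.cast_neg, AddChar.map_neg_eq_conj]

lemma sum_character {t : ℤ} (ht : |t| ≤ n) :
    ∑ j ∈ Finset.range (n + 1), character n j t = if t = 0 then (n : ℂ) + 1 else 0 := by
  have cast_eq_zero_iff : (t : ZMod (n + 1)) = 0 ↔ t = 0 := by
    rw [ZMod.intCast_zmod_eq_zero_iff_dvd]
    exact ⟨fun h => Int.eq_zero_of_abs_lt_dvd h (by lia), fun h => h ▸ dvd_zero _⟩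
  have sum_zmod : ∑ j : ZMod (n + 1), ZMod.stdAddChar (j * (t : ZMod (n + 1)))
      = if t = 0 then (n : ℂ) + 1 else 0 := by
    simp [AddChar.sum_mulShift _ (ZMod.isPrimitive_stdAddChar (n + 1)), cast_eq_zero_iff]
  rw [← sum_zmod, Finset.sum_range]
  refine Fintype.sum_congr _ _ fun j : Fin (n + 1) => ?_
  rw [character, Int.cast_mul, Int.cast_natCast]
  congr 2
  exact ZMod.natCast_zmod_val (n := n + 1) j

lemma dft_eq (x : Signal) (j : ℕ) : dft n x j = ((√((n : ℝ) + 1))⁻¹ : ℂ) *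
    ∑ t ∈ Finset.range (n + 1), x (t : ℤ) * character n j t := by
  simp_rw [dft, character, ZMod.stdAddChar_coe]
  push_cast
  simp only [mul_assoc]

lemma ofReal_inv_sqrt_mul_self :
    ((√((n : ℝ) + 1))⁻¹ : ℂ) * ((√((n : ℝ) + 1))⁻¹ : ℂ) = ((n : ℂ) + 1)⁻¹ := by
  rw [← mul_inv, ← Complex.ofReal_mul, Real.mul_self_sqrt (by positivity)]
  push_cast
  rfl

lemma dft_inversion (x : Signal) {s : ℕ} (hs : s ∈ Finset.range (n + 1)) :
    ∑ j ∈ Finset.range (n + 1), dft n x j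
      * (((√((n : ℝ) + 1))⁻¹ : ℂ) * character n j (-(s : ℤ))) = x s := by
  have term_eq (j : ℕ) : dft n x j * (((√((n : ℝ) + 1))⁻¹ : ℂ) * character n j (-(s : ℤ)))
      = ∑ t ∈ Finset.range (n + 1), ((n : ℂ) + 1)⁻¹ * x (t : ℤ)
          * character n j ((t : ℤ) - s) := by
    rw [dft_eq, mul_mul_mul_comm, ofReal_inv_sqrt_mul_self, Finset.sum_mul, Finset.mul_sum]
    simp_rw [sub_eq_add_neg, character_add, mul_assoc]
  simp_rw [term_eq]
  rw [Finset.sum_comm]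
  simp_rw [← Finset.mul_sum]
  rw [Finset.mem_range] at hs
  rw [Finset.sum_eq_single_of_mem s (Finset.mem_range.mpr hs)]
  · rw [sub_self, sum_character (by simp), if_pos rfl]
    field_simp [Nat.cast_add_one_ne_zero (R := ℂ) n]
  · intro t ht hts
    rw [Finset.mem_range] at ht
    rw [sum_character (abs_le.mpr (by lia)), if_neg (by lia), mul_zero]

lemma sum_norm_dft_sq (x : Signal) :
    ∑ j ∈ Finset.range (n + 1), ‖dft n x j‖ ^ 2
      = ∑ t ∈ Finset.range (n + 1), ‖x (t : ℤ)‖ ^ 2 := by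
  have conj_dft (j : ℕ) : conj (dft n x j) = ∑ t ∈ Finset.range (n + 1),
      conj (x (t : ℤ)) * (((√((n : ℝ) + 1))⁻¹ : ℂ) * character n j (-(t : ℤ))) := by
    simp only [dft_eq, map_mul, map_sum, map_inv₀, Complex.conj_ofReal, conj_character,
      Finset.mul_sum, mul_left_comm]
  apply Complex.ofReal_injective
  push_cast
  calc _ = ∑ j ∈ Finset.range (n + 1), ∑ t ∈ Finset.range (n + 1), conj (x (t : ℤ))
          * (dft n x j * (((√((n : ℝ) + 1))⁻¹ : ℂ) * character n j (-(t : ℤ)))) := by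
        simp_rw [← Complex.conj_mul', conj_dft, Finset.sum_mul]
        refine Finset.sum_congr rfl fun j _ => Finset.sum_congr rfl fun t _ => ?_
        ring
    _ = ∑ t ∈ Finset.range (n + 1), (‖x (t : ℤ)‖ : ℂ) ^ 2 := by
        rw [Finset.sum_comm]
        refine Finset.sum_congr rfl fun t ht => ?_
        rw [← Finset.mul_sum, dft_inversion x ht, Complex.conj_mul']

/-- The times `-k, …, n - k` at which the `k`-interpolating estimator is fitted to the observations;
also the times where its filter may be nonzero. -/
noncomputable abbrev fitWindow (n k : ℕ) : Finset ℤ := Finset.Icc (-(k : ℤ)) ((n : ℤ) - k)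

lemma card_fitWindow (n k : ℕ) : (fitWindow n k).card = n + 1 := by
  rw [Int.card_Icc]
  lia

lemma sum_range_sub_eq_sum_fitWindow {M : Type*} [AddCommMonoid M] (n k : ℕ) (f : ℤ → M) :
    ∑ t ∈ Finset.range (n + 1), f ((t : ℤ) - k)
      = ∑ τ ∈ fitWindow n k, f τ := by
  refine Finset.sum_bij' (fun t _ => (t : ℤ) - k) (fun τ _ => (τ + k).toNat) ?_ ?_ ?_ ?_
    fun _ _ => rfl <;> simp only [Finset.mem_range, Finset.mem_Icc] <;> lia

/-- The Fourier atoms supported on `[-k, n - k]`, of unit `ℓ₂`-norm. The filters supported there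
are their combinations with the coefficients that `fourierL1Norm` measures. -/
noncomputable def atom (n k j : ℕ) : Signal := fun τ =>
  if τ ∈ fitWindow n k then
    ((√((n : ℝ) + 1))⁻¹ : ℂ) * character n j (-(τ + k)) else 0

lemma supportedOn_atom (n k j : ℕ) : SupportedOn (-(k : ℤ)) ((n : ℤ) - k) (atom n k j) :=
  fun t ht => if_neg (by simpa using ht)

lemma norm_atom_sq_le (n k j : ℕ) (τ : ℤ) : ‖atom n k j τ‖ ^ 2 ≤ 1 / ((n : ℝ) + 1) := by
  rw [atom]
  split_ifs
  · rw [norm_mul, norm_character, mul_one, norm_inv, Complex.norm_real, inv_pow,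
      Real.norm_eq_abs, sq_abs, Real.sq_sqrt (by positivity), one_div]
  · simp only [norm_zero, ne_eq, OfNat.ofNat_ne_zero, not_false_eq_true, zero_pow]
    positivity

lemma energy_atom_le_one (n k j : ℕ) : energy (atom n k j) ≤ 1 := by
  rw [(supportedOn_atom n k j).energy_eq_sum]
  refine (Finset.sum_le_card_nsmul _ _ _ fun τ _ => norm_atom_sq_le n k j τ).trans_eq ?_
  rw [card_fitWindow, nsmul_eq_mul]
  push_cast
  exact mul_one_div_cancel (by positivity)

lemma SupportedOn.eq_sum_atom (h : SupportedOn (-(k : ℤ)) ((n : ℤ) - k) ψ) :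
    ψ = ∑ j ∈ Finset.range (n + 1), dft n (shift k ψ) j • atom n k j := by
  ext τ
  simp only [Finset.sum_apply, Pi.smul_apply, smul_eq_mul, atom]
  split_ifs with hτ
  · rw [Finset.mem_Icc] at hτ
    obtain ⟨s, hs⟩ := Int.eq_ofNat_of_zero_le (show 0 ≤ τ + k by lia)
    rw [hs, dft_inversion (shift k ψ) (Finset.mem_range.mpr (by lia)), shift, ← hs,
      add_sub_cancel_right]
  · simp [h.apply_eq_zero hτ]

lemma SupportedOn.sum_norm_dft_shift_sq (h : SupportedOn (-(k : ℤ)) ((n : ℤ) - k) ψ) :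
    ∑ j ∈ Finset.range (n + 1), ‖dft n (shift k ψ) j‖ ^ 2 = energy ψ := by
  rw [sum_norm_dft_sq, h.energy_eq_sum]
  exact sum_range_sub_eq_sum_fitWindow n k fun τ => ‖ψ τ‖ ^ 2

lemma SupportedOn.conv_character (h : SupportedOn (-(k : ℤ)) ((n : ℤ) - k) ψ) (j : ℕ) :
    conv ψ (fun t => character n j (-t))
      = ((√((n : ℝ) + 1) : ℂ) * character n j (-k) * dft n (shift k ψ) j)
        • (fun t => character n j (-t) : Signal) := by
  have sqrt_ne_zero : ((√((n : ℝ) + 1) : ℝ) : ℂ) ≠ 0 :=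
    Complex.ofReal_ne_zero.mpr (Real.sqrt_pos.mpr (by positivity)).ne'
  have eigenvalue_eq : (√((n : ℝ) + 1) : ℂ) * character n j (-k) * dft n (shift k ψ) j
      = ∑ τ ∈ fitWindow n k, ψ τ * character n j τ := by
    rw [dft_eq, mul_mul_mul_comm, mul_inv_cancel₀ sqrt_ne_zero, one_mul, Finset.mul_sum,
      ← sum_range_sub_eq_sum_fitWindow]
    simp_rw [shift, sub_eq_neg_add, character_add, mul_left_comm]
  ext t
  rw [Pi.smul_apply, smul_eq_mul, eigenvalue_eq, h.conv_apply, Finset.sum_mul]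
  refine Finset.sum_congr rfl fun τ _ => ?_
  rw [neg_sub, sub_eq_add_neg, character_add, mul_assoc]

lemma norm_dft_shift_conv_self (hφ : SupportedOn (-(k : ℤ)) ((n : ℤ) - k) φ)
    (hφφ : SupportedOn (-(k : ℤ)) ((n : ℤ) - k) (conv φ φ)) (j : ℕ) :
    ‖dft n (shift k (conv φ φ)) j‖ = √((n : ℝ) + 1) * ‖dft n (shift k φ) j‖ ^ 2 := by
  have sqrt_pos : 0 < √((n : ℝ) + 1) := Real.sqrt_pos.mpr (by positivity)
  have eigenvalue_mul := congrFun (hφ.conv_assoc hφ fun t => character n j (-t)) 0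
  rw [hφφ.conv_character, hφ.conv_character, hφ.conv_smul, hφ.conv_character] at eigenvalue_mul
  have norm_eq := congrArg norm eigenvalue_mul
  simp only [Pi.smul_apply, smul_eq_mul, neg_zero, character_zero, mul_one, norm_mul,
    Complex.norm_real, norm_character, Real.norm_of_nonneg sqrt_pos.le] at norm_eq
  apply mul_left_cancel₀ sqrt_pos.ne'
  linear_combination norm_eq

lemma fourierL1Norm_shift_conv_self (hφ : SupportedOn (-(k : ℤ)) ((n : ℤ) - k) φ)
    (hφφ : SupportedOn (-(k : ℤ)) ((n : ℤ) - k) (conv φ φ)) :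
    fourierL1Norm n (shift k (conv φ φ)) = √((n : ℝ) + 1) * energy φ := by
  simp_rw [fourierL1Norm, norm_dft_shift_conv_self hφ hφφ, ← Finset.mul_sum,
    hφ.sum_norm_dft_shift_sq]

end Fourier

section NoiseSpace

lemma hilbertSchmidtSq_toEuclideanCLM {ι : Type*} [Fintype ι] [DecidableEq ι]
    (A : Matrix ι ι ℂ) :
    hilbertSchmidtSq (Matrix.toEuclideanCLM (𝕜 := ℂ) A) = ∑ i, ∑ j, ‖A i j‖ ^ 2 := by
  rw [Finset.sum_comm]
  refine Finset.sum_congr rfl fun j _ => ?_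
  rw [EuclideanSpace.norm_sq_eq]
  simp [Matrix.ofLp_toEuclideanCLM]

lemma trace_toEuclideanCLM {ι : Type*} [Fintype ι] [DecidableEq ι] (A : Matrix ι ι ℂ) :
    LinearMap.trace ℂ _ (Matrix.toEuclideanCLM (𝕜 := ℂ) A).toLinearMap = A.trace := by
  rw [LinearMap.trace_eq_sum_inner _ (EuclideanSpace.basisFun ι ℂ), Matrix.trace]
  refine Finset.sum_congr rfl fun i _ => ?_
  simp [Matrix.ofLp_toEuclideanCLM, EuclideanSpace.inner_single_left]

/-- Restriction of a sequence to the times in `U`. -/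
noncomputable def restr (U : Finset ℤ) : Signal →ₗ[ℂ] EuclideanSpace ℂ U where
  toFun u := WithLp.toLp 2 fun t => u t
  map_add' _ _ := rfl
  map_smul' _ _ := rfl

/-- Restriction of a sequence to the times in `W`, extended by zero to a vector indexed by `U` so
that it can be paired with the noise on `U`. -/
noncomputable def window (U W : Finset ℤ) : Signal →ₗ[ℂ] EuclideanSpace ℂ U where
  toFun u := WithLp.toLp 2 fun t => if (t : ℤ) ∈ W then u t else 0
  map_add' u v := by
    ext t
    simp only [PiLp.add_apply, Pi.add_apply]
    split_ifs <;> simp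
  map_smul' r u := by
    ext t
    simp only [PiLp.smul_apply, Pi.smul_apply]
    split_ifs <;> simp

/-- The operator mapping the noise on `U` to the restriction to `W` of the noise filtered by
`ψ`. -/
noncomputable def filterOp (U W : Finset ℤ) (ψ : Signal) :
    EuclideanSpace ℂ U →L[ℂ] EuclideanSpace ℂ U :=
  Matrix.toEuclideanCLM (𝕜 := ℂ)
    (Matrix.of fun t s : U => if (t : ℤ) ∈ W then ψ ((t : ℤ) - s) else 0)

/-- The vector representing the linear form `z ↦ (ψ * z)_t` of the noise on `U`. -/
noncomputable def convForm (U : Finset ℤ) (ψ : Signal) (t : ℤ) : EuclideanSpace ℂ U :=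
  WithLp.toLp 2 fun s => conj (ψ (t - s))

variable {U W : Finset ℤ} {a b : ℤ} {ψ : Signal}

lemma restr_apply (u : Signal) (t : U) : restr U u t = u t := rfl

lemma window_apply (u : Signal) (t : U) :
    window U W u t = if (t : ℤ) ∈ W then u t else 0 := rfl

lemma inner_window_window (u v : Signal) :
    inner ℂ (window U W u) (window U W v) = inner ℂ (restr U u) (window U W v) := by
  rw [PiLp.inner_apply, PiLp.inner_apply]
  refine Finset.sum_congr rfl fun t _ => ?_
  rw [window_apply, window_apply]
  split_ifs
  · rfl
  · simp

lemma sum_coe_ite_mem {M : Type*} [AddCommMonoid M] (hWU : W ⊆ U) (f : ℤ → M) :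
    ∑ t : U, (if (t : ℤ) ∈ W then f t else 0) = ∑ t ∈ W, f t := by
  rw [Finset.sum_coe_sort U fun t => if t ∈ W then f t else 0, Finset.sum_ite_mem,
    Finset.inter_eq_right.mpr hWU]

lemma norm_window_sq (hWU : W ⊆ U) (u : Signal) :
    ‖window U W u‖ ^ 2 = ∑ t ∈ W, ‖u t‖ ^ 2 := by
  rw [EuclideanSpace.norm_sq_eq, ← sum_coe_ite_mem hWU]
  refine Finset.sum_congr rfl fun t _ => ?_
  rw [window_apply]
  split_ifs <;> simp

lemma filterOp_restr (h : ∀ t ∈ W, ∀ u ∉ U, ψ (t - u) = 0) (z : Signal) :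
    filterOp U W ψ (restr U z) = window U W (conv ψ z) := by
  ext t
  rw [filterOp, Matrix.ofLp_toEuclideanCLM, window_apply, Matrix.mulVec, dotProduct]
  simp only [Matrix.of_apply]
  split_ifs with ht
  · rw [conv_eq_sum_sub z (h t ht), ← Finset.sum_coe_sort U]
    rfl
  · simp

lemma SupportedOn.hilbertSchmidtSq_filterOp_le (h : SupportedOn a b ψ) (hWU : W ⊆ U) :
    hilbertSchmidtSq (filterOp U W ψ) ≤ W.card * energy ψ := by
  rw [filterOp, hilbertSchmidtSq_toEuclideanCLM, ← nsmul_eq_mul, ← Finset.sum_const,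
    ← sum_coe_ite_mem hWU]
  refine Finset.sum_le_sum fun t _ => ?_
  simp only [Matrix.of_apply]
  split_ifs
  · rw [Finset.sum_coe_sort U fun s => ‖ψ ((t : ℤ) - s)‖ ^ 2]
    exact h.sum_norm_sq_sub_le_energy _ _
  · simp

lemma trace_filterOp (hWU : W ⊆ U) (ψ : Signal) :
    LinearMap.trace ℂ _ (filterOp U W ψ).toLinearMap = W.card * ψ 0 := by
  rw [filterOp, trace_toEuclideanCLM, ← nsmul_eq_mul, ← Finset.sum_const, ← sum_coe_ite_mem hWU]
  simp [Matrix.trace]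

lemma inner_convForm {t : ℤ} (h : ∀ u ∉ U, ψ (t - u) = 0) (z : Signal) :
    inner ℂ (convForm U ψ t) (restr U z) = conv ψ z t := by
  rw [conv_eq_sum_sub z h, ← Finset.sum_coe_sort U, PiLp.inner_apply]
  exact Finset.sum_congr rfl fun s _ => by simp [convForm, restr_apply, mul_comm]

lemma norm_convForm_sq (U : Finset ℤ) (ψ : Signal) (t : ℤ) :
    ‖convForm U ψ t‖ ^ 2 = ∑ u ∈ U, ‖ψ (t - u)‖ ^ 2 := by
  rw [EuclideanSpace.norm_sq_eq, ← Finset.sum_coe_sort U]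
  simp [convForm]

lemma SupportedOn.norm_convForm_sq_le (h : SupportedOn a b ψ) (t : ℤ) :
    ‖convForm U ψ t‖ ^ 2 ≤ energy ψ :=
  (norm_convForm_sq U ψ t).trans_le (h.sum_norm_sq_sub_le_energy t U)

end NoiseSpace

section WindowResidual

/-- The vectors in `EuclideanSpace ℂ U` obtained by restricting the elements of `S` to `W`. -/
noncomputable def windowSpace (U W : Finset ℤ) (S : Submodule ℂ Signal) :
    Submodule ℂ (EuclideanSpace ℂ U) :=
  S.map (window U W)

/-- The part of the restriction of a sequence to `W` that is orthogonal to the restrictions of the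
elements of `S`. -/
noncomputable def windowResidual (U W : Finset ℤ) (S : Submodule ℂ Signal) :
    Signal →ₗ[ℂ] EuclideanSpace ℂ U :=
  (windowSpace U W S)ᗮ.starProjection.toLinearMap ∘ₗ window U W

variable {U W : Finset ℤ} {S : Submodule ℂ Signal}

lemma windowResidual_eq_sub (u : Signal) :
    windowResidual U W S u = window U W u - (windowSpace U W S).starProjection (window U W u) :=
  Submodule.starProjection_orthogonal_val _

lemma window_mem_windowSpace {v : Signal} (hv : v ∈ S) : window U W v ∈ windowSpace U W S :=
  Submodule.mem_map_of_mem hv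

lemma windowResidual_eq_zero {v : Signal} (hv : v ∈ S) : windowResidual U W S v = 0 := by
  rw [windowResidual_eq_sub,
    Submodule.starProjection_eq_self_iff.2 (window_mem_windowSpace hv), sub_self]

lemma norm_windowResidual_le (u : Signal) : ‖windowResidual U W S u‖ ≤ ‖window U W u‖ :=
  Submodule.norm_starProjection_apply_le _ _

lemma starProjection_window (z : Signal) :
    (windowSpace U W S).starProjection (window U W z)
      = (windowSpace U W S).starProjection (restr U z) := by
  rw [← sub_eq_zero, ← map_sub, Submodule.starProjection_apply_eq_zero_iff]
  rintro _ ⟨v, -, rfl⟩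
  rw [inner_sub_right, sub_eq_zero, ← inner_conj_symm, inner_window_window, inner_conj_symm]

lemma inner_starProjection_orthogonal_window (z v : Signal) :
    inner ℂ ((windowSpace U W S)ᗮ.starProjection (window U W z)) (window U W v)
      = inner ℂ (restr U z) (windowResidual U W S v) := by
  rw [Submodule.starProjection_orthogonal_val, inner_sub_left, starProjection_window,
    inner_window_window, windowResidual_eq_sub, inner_sub_right,
    Submodule.inner_starProjection_left_eq_right]

end WindowResidual

section NoiseLaw

/-- The law of a two-sided sequence of i.i.d. standard complex Gaussian variables. -/
noncomputable def noiseLaw : Measure Signal := Measure.infinitePi fun _ => stdComplexGaussian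

instance : IsProbabilityMeasure noiseLaw :=
  inferInstanceAs (IsProbabilityMeasure (Measure.infinitePi _))

lemma IsStdComplexNoise.measurable_path {Ω : Type*} [MeasurableSpace Ω] {P : Measure Ω}
    {ζ : ℤ → Ω → ℂ} (hζ : IsStdComplexNoise P ζ) : Measurable fun ω t => ζ t ω :=
  measurable_pi_lambda _ hζ.measurable

lemma IsStdComplexNoise.map_path {Ω : Type*} [MeasurableSpace Ω] {P : Measure Ω}
    {ζ : ℤ → Ω → ℂ} (hζ : IsStdComplexNoise P ζ) :
    P.map (fun ω t => ζ t ω) = noiseLaw := by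
  rw [hζ.indep.map_fun_eq_infinitePi_map hζ.measurable, noiseLaw]
  simp only [hζ.law]

lemma measurable_restr (U : Finset ℤ) : Measurable (restr U) :=
  (WithLp.measurable_toLp 2 _).comp (U.measurable_restrict)

lemma map_restr_noiseLaw (U : Finset ℤ) : noiseLaw.map (restr U) = complexGaussian U := by
  rw [complexGaussian, ← Measure.infinitePi_map_restrict (I := U) fun _ : ℤ => stdComplexGaussian,
    Measure.map_map (WithLp.measurable_toLp 2 (U → ℂ)) (by fun_prop)]
  rfl

lemma noiseLaw_preimage_restr_le (U : Finset ℤ) (B : Set (EuclideanSpace ℂ U)) :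
    noiseLaw (restr U ⁻¹' B) ≤ complexGaussian U B :=
  (Measure.le_map_apply (measurable_restr U).aemeasurable B).trans_eq
    (by rw [map_restr_noiseLaw])

end NoiseLaw

section NoiseTails

variable {U W : Finset ℤ} {S : Submodule ℂ Signal} {a b : ℤ} {ψ : Signal} {V δ : ℝ}

lemma SupportedOn.noiseLaw_sum_norm_conv_sq_gt_le (h : SupportedOn a b ψ) {T : Finset ℤ}
    (hV : T.card * energy ψ ≤ V) (hδ : 0 < δ) :
    noiseLaw {z | 4 * V * Real.log (2 / δ) < ∑ t ∈ T, ‖conv ψ z t‖ ^ 2}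
      ≤ ENNReal.ofReal δ := by
  set U := T.biUnion fun t => Finset.Icc (t - b) (t - a)
  have inner_convForm_eq (z : Signal) (t : ℤ) (ht : t ∈ T) :
      inner ℂ (convForm U ψ t) (restr U z) = conv ψ z t :=
    inner_convForm (h.apply_sub_eq_zero
      (Finset.subset_biUnion_of_mem (fun t => Finset.Icc (t - b) (t - a)) ht)) z
  have sum_convForm_le : ∑ t ∈ T, ‖convForm U ψ t‖ ^ 2 ≤ V :=
    (Finset.sum_le_card_nsmul _ _ _ fun t _ => h.norm_convForm_sq_le t).trans
      (by rwa [nsmul_eq_mul])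
  refine le_trans ?_ ((noiseLaw_preimage_restr_le U _).trans
    (measure_sum_norm_sq_inner_gt_le sum_convForm_le hδ))
  refine measure_mono fun z hz => ?_
  rw [Set.mem_preimage, Set.mem_ofPred_eq,
    Finset.sum_congr rfl fun t ht => by rw [inner_convForm_eq z t ht]]
  exact hz

/-- The correlation of the noise on `U` with the part of a sequence on `W` that is orthogonal to
the restrictions of the elements of `S`. -/
noncomputable def noiseCorrelation (U W : Finset ℤ) (S : Submodule ℂ Signal) (z : Signal) :
    Signal →ₗ[ℂ] ℂ :=
  (innerSL ℂ (restr U z)).toLinearMap ∘ₗ windowResidual U W S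

lemma noiseCorrelation_apply (z v : Signal) :
    noiseCorrelation U W S z v = inner ℂ (restr U z) (windowResidual U W S v) := rfl

lemma noiseLaw_sum_norm_noiseCorrelation_sq_gt_le {κ : Type*} {s : Finset κ} {v : κ → Signal}
    (hV : ∀ i ∈ s, ‖windowResidual U W S (v i)‖ ^ 2 ≤ V) (hδ : 0 < δ) :
    noiseLaw {z | 4 * (s.card * V) * Real.log (2 / δ)
        < ∑ i ∈ s, ‖noiseCorrelation U W S z (v i)‖ ^ 2} ≤ ENNReal.ofReal δ := by
  simp_rw [noiseCorrelation_apply, norm_inner_symm (restr U _)]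
  refine (noiseLaw_preimage_restr_le U _).trans (measure_sum_norm_sq_inner_gt_le ?_ hδ)
  exact (Finset.sum_le_card_nsmul _ _ _ hV).trans_eq (nsmul_eq_mul _ _)

lemma noiseLaw_norm_sq_starProjection_window_gt_le [FiniteDimensional ℂ S] (hδ : 0 < δ) :
    noiseLaw {z | 4 * Real.log (2 ^ Module.finrank ℂ S / δ)
        < ‖(windowSpace U W S).starProjection (window U W z)‖ ^ 2} ≤ ENNReal.ofReal δ := by
  refine le_trans ?_ ((noiseLaw_preimage_restr_le U _).trans
    (measure_norm_sq_starProjection_gt_le (windowSpace U W S) hδ))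
  refine measure_mono fun z hz => ?_
  rw [Set.mem_ofPred_eq, starProjection_window] at hz
  refine lt_of_le_of_lt ?_ hz
  gcongr
  · exact one_le_two
  · exact Submodule.finrank_map_le _ _

lemma SupportedOn.noiseLaw_norm_noiseCorrelation_conv_gt_le [FiniteDimensional ℂ S]
    (h : SupportedOn a b ψ) (hWU : W ⊆ U) (hU : ∀ t ∈ W, Finset.Icc (t - b) (t - a) ⊆ U)
    (hV : 0 < V) (hE : W.card * energy ψ ≤ V) {T : ℝ} (hT : W.card * ‖ψ 0‖ ≤ T)
    (hδ : 0 < δ) :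
    noiseLaw {z | 2 * (√(8 * V) * Real.log (2 / δ) + 2 * (T + √(Module.finrank ℂ S) * √V))
        < ‖noiseCorrelation U W S z (conv ψ z)‖} ≤ 4 * ENNReal.ofReal δ := by
  set Y := windowSpace U W S
  have hilbertSchmidtSq_le : hilbertSchmidtSq (filterOp U W ψ) ≤ V :=
    (h.hilbertSchmidtSq_filterOp_le hWU).trans hE
  have trace_le : ‖LinearMap.trace ℂ _ (Yᗮ.starProjection ∘L filterOp U W ψ).toLinearMap‖
      ≤ T + √(Module.finrank ℂ S) * √V := by
    refine (norm_trace_starProjection_orthogonal_comp_le Y (filterOp U W ψ)).trans ?_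
    rw [trace_filterOp hWU, norm_mul, Complex.norm_natCast]
    gcongr
    exact Submodule.finrank_map_le _ _
  refine le_trans ?_ ((noiseLaw_preimage_restr_le U _).trans (measure_norm_quadratic_gt_le hV
    ((hilbertSchmidtSq_starProjection_comp_le Yᗮ _).trans hilbertSchmidtSq_le) trace_le hδ))
  refine measure_mono fun z hz => ?_
  rw [Set.mem_preimage, Set.mem_ofPred_eq, ContinuousLinearMap.comp_apply,
    filterOp_restr fun t ht => h.apply_sub_eq_zero (hU t ht)]
  exact hz

end NoiseTails

section GoodNoise

variable {n k : ℕ} {S : Submodule ℂ Signal} {φ ε : Signal} {T : Finset ℤ} {V B α : ℝ} {a b : ℤ}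

/-- The times `-n, …, n` of the noise that enters a filtered sequence on `fitWindow n k`. -/
noncomputable abbrev noiseWindow (n : ℕ) : Finset ℤ := Finset.Icc (-(n : ℤ)) n

lemma fitWindow_subset_noiseWindow (hk : k ≤ n) : fitWindow n k ⊆ noiseWindow n :=
  Finset.Icc_subset_Icc (by lia) (by lia)

/-- The noise realizations for which all random quantities in the analysis of the estimator are
small: `φ` is the oracle filter, observed on `T`, and `ε` is the deviation of the signal from `S`.
The estimated filters are controlled through the Fourier atoms. -/
structure GoodNoise (n k : ℕ) (S : Submodule ℂ Signal) (φ ε : Signal) (T : Finset ℤ)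
    (V B α : ℝ) (z : Signal) : Prop where
  oracle : ∑ t ∈ T, ‖conv φ z t‖ ^ 2 ≤ 4 * V * Real.log (16 / α)
  bias : ‖noiseCorrelation (noiseWindow n) (fitWindow n k) S z ε‖ ^ 2
    ≤ 4 * B ^ 2 * Real.log (16 / α)
  shifted_bias :
    ∑ τ ∈ fitWindow n k, ‖noiseCorrelation (noiseWindow n) (fitWindow n k) S z (shift τ ε)‖ ^ 2
      ≤ 4 * ((n + 1) * B ^ 2) * Real.log (16 / α)
  projection : ‖(windowSpace (noiseWindow n) (fitWindow n k) S).starProjection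
      (window (noiseWindow n) (fitWindow n k) z)‖ ^ 2
    ≤ 4 * Real.log (2 ^ Module.finrank ℂ S / (α / 8))
  atom_conv : ∀ t ∈ fitWindow n k, ∀ j ∈ Finset.range (n + 1),
    ‖conv (atom n k j) z t‖ ^ 2 ≤ 4 * Real.log (64 * (n + 1) ^ 2 / α)
  atom_correlation : ∀ j ∈ Finset.range (n + 1),
    ‖noiseCorrelation (noiseWindow n) (fitWindow n k) S z (conv (atom n k j) z)‖
      ≤ 2 * (√(8 * (n + 1)) * Real.log (64 * (n + 1) ^ 2 / α)
        + 2 * (√(n + 1) + √(Module.finrank ℂ S) * √(n + 1)))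

lemma measure_exists_mem_le {E κ : Type*} [MeasurableSpace E] {μ : Measure E} {s : Finset κ}
    {p : κ → E → Prop} {δ : ℝ} (h : ∀ i ∈ s, μ {z | p i z} ≤ ENNReal.ofReal δ) :
    μ {z | ∃ i ∈ s, p i z} ≤ ENNReal.ofReal (s.card * δ) := by
  have union_eq : {z | ∃ i ∈ s, p i z} = ⋃ i ∈ s, {z | p i z} := by ext z; simp
  rw [union_eq, ENNReal.ofReal_mul (by positivity), ENNReal.ofReal_natCast, ← nsmul_eq_mul]
  exact (measure_biUnion_finset_le _ _).trans (Finset.sum_le_card_nsmul _ _ _ h)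

lemma noiseLaw_exists_norm_conv_atom_sq_gt_le (n k : ℕ) (hα : 0 < α) :
    noiseLaw {z | ∃ p ∈ fitWindow n k ×ˢ Finset.range (n + 1),
        4 * Real.log (64 * (n + 1) ^ 2 / α) < ‖conv (atom n k p.2) z p.1‖ ^ 2}
      ≤ ENNReal.ofReal (α / 8) := by
  set δ := α / (32 * ((n : ℝ) + 1) ^ 2) with hδ
  have log_eq : 2 / δ = 64 * (n + 1) ^ 2 / α := by rw [hδ]; field_simp; norm_num
  have atom_tail (t : ℤ) (j : ℕ) : noiseLaw {z | 4 * Real.log (64 * (n + 1) ^ 2 / α)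
      < ‖conv (atom n k j) z t‖ ^ 2} ≤ ENNReal.ofReal δ := by
    simpa [log_eq] using (supportedOn_atom n k j).noiseLaw_sum_norm_conv_sq_gt_le (T := {t})
      (V := 1) (by simpa using energy_atom_le_one n k j) (by positivity : 0 < δ)
  refine (measure_exists_mem_le fun p _ => atom_tail p.1 p.2).trans (ENNReal.ofReal_le_ofReal ?_)
  rw [Finset.card_product, card_fitWindow, Finset.card_range, hδ]
  push_cast
  field_simp
  norm_num

lemma noiseLaw_exists_norm_noiseCorrelation_atom_gt_le [FiniteDimensional ℂ S] (hk : k ≤ n)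
    (hα : 0 < α) :
    noiseLaw {z | ∃ j ∈ Finset.range (n + 1),
        2 * (√(8 * (n + 1)) * Real.log (64 * (n + 1) ^ 2 / α)
          + 2 * (√(n + 1) + √(Module.finrank ℂ S) * √(n + 1)))
        < ‖noiseCorrelation (noiseWindow n) (fitWindow n k) S z (conv (atom n k j) z)‖}
      ≤ ENNReal.ofReal (α / 8) := by
  set δ := α / (32 * ((n : ℝ) + 1) ^ 2) with hδ
  have log_eq : 2 / δ = 64 * (n + 1) ^ 2 / α := by rw [hδ]; field_simp; norm_num
  have card_eq : ((fitWindow n k).card : ℝ) = n + 1 := by rw [card_fitWindow]; push_cast; rfl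
  have mass_le (j : ℕ) : ((n : ℝ) + 1) * ‖atom n k j 0‖ ≤ √(n + 1) := by
    refine Real.le_sqrt_of_sq_le ?_
    calc _ = ((n : ℝ) + 1) ^ 2 * ‖atom n k j 0‖ ^ 2 := mul_pow _ _ _
      _ ≤ ((n : ℝ) + 1) ^ 2 * (1 / (n + 1)) := by grw [norm_atom_sq_le]
      _ = n + 1 := by field_simp
  have atom_tail (j : ℕ) : noiseLaw {z | 2 * (√(8 * (n + 1)) * Real.log (64 * (n + 1) ^ 2 / α)
      + 2 * (√(n + 1) + √(Module.finrank ℂ S) * √(n + 1)))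
      < ‖noiseCorrelation (noiseWindow n) (fitWindow n k) S z (conv (atom n k j) z)‖}
      ≤ ENNReal.ofReal (4 * δ) := by
    rw [← log_eq, ENNReal.ofReal_mul four_pos.le, ENNReal.ofReal_ofNat]
    refine (supportedOn_atom n k j).noiseLaw_norm_noiseCorrelation_conv_gt_le
      (fitWindow_subset_noiseWindow hk) (fun t ht => ?_) (by positivity) ?_ ?_ (by positivity)
    · rw [Finset.mem_Icc] at ht
      exact Finset.Icc_subset_Icc (by lia) (by lia)
    · rw [card_eq]
      exact mul_le_of_le_one_right (by positivity) (energy_atom_le_one n k j)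
    · rw [card_eq]
      exact mass_le j
  refine (measure_exists_mem_le fun j _ => atom_tail j).trans (ENNReal.ofReal_le_ofReal ?_)
  rw [Finset.card_range, hδ]
  push_cast
  field_simp
  linarith [n.cast_nonneg (α := ℝ)]

lemma shift_zero (u : Signal) : shift 0 u = u := by
  ext t
  simp [shift]

lemma noiseLaw_not_goodNoise_le [FiniteDimensional ℂ S] (hk : k ≤ n) (hφ : SupportedOn a b φ)
    (hV : T.card * energy φ ≤ V)
    (hε : ∀ τ ∈ fitWindow n k,
      ‖windowResidual (noiseWindow n) (fitWindow n k) S (shift τ ε)‖ ^ 2 ≤ B ^ 2)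
    (hα : 0 < α) :
    noiseLaw {z | ¬ GoodNoise n k S φ ε T V B α z} ≤ ENNReal.ofReal α := by
  have hα8 : 0 < α / 8 := by positivity
  have log_eq : 2 / (α / 8) = 16 / α := by field_simp; norm_num
  have bias_le : ‖windowResidual (noiseWindow n) (fitWindow n k) S ε‖ ^ 2 ≤ B ^ 2 := by
    simpa only [shift_zero] using hε 0 (Finset.mem_Icc.mpr (by lia))
  have oracle_tail := hφ.noiseLaw_sum_norm_conv_sq_gt_le hV hα8
  have bias_tail := noiseLaw_sum_norm_noiseCorrelation_sq_gt_le (s := {()}) (v := fun _ => ε)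
    (fun _ _ => bias_le) hα8
  have shifted_bias_tail := noiseLaw_sum_norm_noiseCorrelation_sq_gt_le hε hα8
  have projection_tail := noiseLaw_norm_sq_starProjection_window_gt_le (U := noiseWindow n)
    (W := fitWindow n k) (S := S) hα8
  have atom_tail := noiseLaw_exists_norm_conv_atom_sq_gt_le n k hα
  have atom_correlation_tail := noiseLaw_exists_norm_noiseCorrelation_atom_gt_le (S := S) hk hα
  simp only [log_eq, Finset.sum_singleton, Finset.card_singleton, Nat.cast_one, one_mul,
    card_fitWindow, Nat.cast_add] at oracle_tail bias_tail shifted_bias_tail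
  have union_le {A A' : Set Signal} {c : ℝ≥0∞} (hA : noiseLaw A ≤ ENNReal.ofReal (α / 8))
      (hA' : noiseLaw A' ≤ c) : noiseLaw (A ∪ A') ≤ ENNReal.ofReal (α / 8) + c :=
    (measure_union_le A A').trans (add_le_add hA hA')
  refine (measure_mono fun z hz => ?_).trans <| (union_le oracle_tail <| union_le bias_tail <|
    union_le shifted_bias_tail <| union_le projection_tail <|
    union_le atom_tail atom_correlation_tail).trans ?_
  · by_contra hmem
    simp only [Set.mem_union, Set.mem_ofPred_eq, not_or, not_lt, not_exists, not_and,
      Finset.mem_product, Prod.forall, and_imp] at hmem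
    obtain ⟨oracle, bias, shifted_bias, projection, atom_conv, atom_correlation⟩ := hmem
    exact hz ⟨oracle, bias, shifted_bias, projection, fun t ht j hj => atom_conv t j ht hj,
      atom_correlation⟩
  · repeat rw [← ENNReal.ofReal_add (by positivity) (by positivity)]
    exact ENNReal.ofReal_le_ofReal (by linarith)

lemma exists_measurableSet_subset_of_measure_compl_le {E : Type*} [MeasurableSpace E]
    {μ : Measure E} [IsProbabilityMeasure μ] {A : Set E} (hα : 0 ≤ α)
    (hA : μ Aᶜ ≤ ENNReal.ofReal α) :
    ∃ G ⊆ A, MeasurableSet G ∧ ENNReal.ofReal (1 - α) ≤ μ G := by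
  refine ⟨(toMeasurable μ Aᶜ)ᶜ, Set.compl_subset_comm.mp (subset_toMeasurable μ Aᶜ),
    (measurableSet_toMeasurable _ _).compl, ?_⟩
  rw [prob_compl_eq_one_sub (measurableSet_toMeasurable _ _), measure_toMeasurable,
    ENNReal.ofReal_sub _ hα, ENNReal.ofReal_one]
  gcongr

end GoodNoise

section FeasibleFilters

variable {n k : ℕ} {r : ℝ} {ψ : Signal}

lemma energy_le_of_mem_feasibleFilters (hψ : ψ ∈ feasibleFilters n k r) :
    energy ψ ≤ r ^ 2 / (n + 1) := by
  have fourier_nonneg : 0 ≤ fourierL1Norm n (shift k ψ) :=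
    Finset.sum_nonneg fun _ _ => norm_nonneg _
  calc energy ψ = ∑ j ∈ Finset.range (n + 1), ‖dft n (shift k ψ) j‖ ^ 2 :=
        hψ.1.sum_norm_dft_shift_sq.symm
    _ ≤ fourierL1Norm n (shift k ψ) ^ 2 :=
        Finset.sum_sq_le_sq_sum_of_nonneg fun _ _ => norm_nonneg _
    _ ≤ (r / √(n + 1)) ^ 2 := pow_le_pow_left₀ fourier_nonneg hψ.2 2
    _ = r ^ 2 / (n + 1) := by rw [div_pow, Real.sq_sqrt (by positivity)]

lemma norm_apply_conv_le_of_mem_feasibleFilters (hψ : ψ ∈ feasibleFilters n k r)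
    (L : Signal →ₗ[ℂ] ℂ) {z : Signal} {Q : ℝ}
    (hQ : ∀ j ∈ Finset.range (n + 1), ‖L (conv (atom n k j) z)‖ ≤ Q) :
    ‖L (conv ψ z)‖ ≤ r / √(n + 1) * Q := by
  have hQ0 : 0 ≤ Q := (norm_nonneg _).trans (hQ 0 (by simp))
  have expansion : L (conv ψ z)
      = ∑ j ∈ Finset.range (n + 1), dft n (shift k ψ) j * L (conv (atom n k j) z) := by
    conv_lhs => rw [hψ.1.eq_sum_atom]
    rw [conv_sum_smul _ _ (supportedOn_atom n k), map_sum]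
    simp only [map_smul, smul_eq_mul]
  calc ‖L (conv ψ z)‖
      ≤ ∑ j ∈ Finset.range (n + 1), ‖dft n (shift k ψ) j‖ * ‖L (conv (atom n k j) z)‖ := by
        rw [expansion]
        exact (norm_sum_le _ _).trans_eq (Finset.sum_congr rfl fun _ _ => norm_mul _ _)
    _ ≤ ∑ j ∈ Finset.range (n + 1), ‖dft n (shift k ψ) j‖ * Q :=
        Finset.sum_le_sum fun j hj => mul_le_mul_of_nonneg_left (hQ j hj) (norm_nonneg _)
    _ = fourierL1Norm n (shift k ψ) * Q := (Finset.sum_mul ..).symm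
    _ ≤ r / √(n + 1) * Q := mul_le_mul_of_nonneg_right hψ.2 hQ0

end FeasibleFilters

section ShiftInvariant

variable {S : Submodule ℂ Signal} {a b : ℤ} {ψ u : Signal}

lemma shift_shift (p q : ℤ) (u : Signal) : shift p (shift q u) = shift (p + q) u := by
  ext t
  simp only [shift, sub_sub]

lemma shift_mem_of_shift_one_mem [FiniteDimensional ℂ S] (h : ∀ u ∈ S, shift 1 u ∈ S)
    (τ : ℤ) (hu : u ∈ S) : shift τ u ∈ S := by
  let shiftS : S →ₗ[ℂ] S :=
    { toFun := fun u => ⟨shift 1 u, h u u.2⟩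
      map_add' := fun _ _ => rfl
      map_smul' := fun _ _ => rfl }
  have injective : Function.Injective shiftS := fun u v huv => by
    have shift_eq : shift 1 (u : Signal) = shift 1 (v : Signal) := congrArg Subtype.val huv
    ext t
    simpa [shift] using congrFun shift_eq (t + 1)
  have shift_neg_one_mem : ∀ u ∈ S, shift (-1) u ∈ S := fun u hu => by
    obtain ⟨v, hv⟩ := LinearMap.injective_iff_surjective.mp injective ⟨u, hu⟩
    have shift_one_v : shift 1 (v : Signal) = u := congrArg Subtype.val hv
    rw [← shift_one_v, shift_shift, neg_add_cancel, shift_zero]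
    exact v.2
  induction τ using Int.induction_on with
  | zero => rwa [shift_zero]
  | succ i ih =>
    rw [add_comm, ← shift_shift]
    exact h _ ih
  | pred i ih =>
    rw [sub_eq_neg_add, ← shift_shift]
    exact shift_neg_one_mem _ ih

lemma SupportedOn.conv_eq_sum_shift (h : SupportedOn a b ψ) (v : Signal) :
    SignalDenoising.conv ψ v = ∑ τ ∈ Finset.Icc a b, ψ τ • shift τ v := by
  ext t
  rw [h.conv_apply, Finset.sum_apply]
  rfl

lemma SupportedOn.conv_mem (hψ : SupportedOn a b ψ)
    (h : ∀ τ : ℤ, shift τ u ∈ S) : SignalDenoising.conv ψ u ∈ S := by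
  rw [hψ.conv_eq_sum_shift]
  exact Submodule.sum_mem _ fun τ _ => S.smul_mem _ (h τ)

end ShiftInvariant

section LeastSquares

/-- Expanding both squares leaves the cross terms `⟪w, d⟫` and `⟪w, d₀⟫`; the components of `w`
along `V` are absorbed into the squares by the arithmetic-geometric mean inequality. -/
lemma norm_sq_le_of_norm_add_smul_sq_le {E : Type*} [NormedAddCommGroup E] [InnerProductSpace ℂ E]
    (V : Submodule ℂ E) [V.HasOrthogonalProjection] {w d d₀ : E} {σ : ℝ} (hσ : 0 ≤ σ)
    (h : ‖d + (σ : ℂ) • w‖ ^ 2 ≤ ‖d₀ + (σ : ℂ) • w‖ ^ 2) :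
    ‖d‖ ^ 2 ≤ 4 * ‖d₀‖ ^ 2 + 6 * σ ^ 2 * ‖V.starProjection w‖ ^ 2
      + 4 * σ * (‖inner ℂ (Vᗮ.starProjection w) d‖ + ‖inner ℂ (Vᗮ.starProjection w) d₀‖) := by
  have expand (u : E) :
      ‖u + (σ : ℂ) • w‖ ^ 2 = ‖u‖ ^ 2 + 2 * σ * (inner ℂ w u).re + ‖(σ : ℂ) • w‖ ^ 2 := by
    rw [norm_add_sq (𝕜 := ℂ), inner_smul_right, RCLike.re_eq_complex_re, Complex.re_ofReal_mul,
      ← inner_conj_symm u w, Complex.conj_re]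
    ring
  have abs_cross_le (u : E) : |(inner ℂ w u).re|
      ≤ ‖V.starProjection w‖ * ‖u‖ + ‖inner ℂ (Vᗮ.starProjection w) u‖ := by
    have split : inner ℂ w u = inner ℂ (V.starProjection w) u
        + inner ℂ (Vᗮ.starProjection w) u := by
      rw [← inner_add_left, V.starProjection_add_starProjection_orthogonal]
    refine (Complex.abs_re_le_norm _).trans ?_
    rw [split]
    exact (norm_add_le _ _).trans (add_le_add_left (norm_inner_le_norm _ _) _)
  rw [expand, expand] at h
  set p := ‖V.starProjection w‖
  have cross_d := mul_le_mul_of_nonneg_left (neg_le_of_abs_le (abs_cross_le d)) hσ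
  have cross_d₀ := mul_le_mul_of_nonneg_left (le_of_abs_le (abs_cross_le d₀)) hσ
  linarith [sq_nonneg (‖d‖ - 2 * σ * p), sq_nonneg (‖d₀‖ - σ * p)]

end LeastSquares

section ErrorRate

variable {n s : ℕ} {ρ κ α : ℝ}

/-- The quantity `ϱ² (1 + ln (1/α)) + E₀` of the risk bounds, for filters of bandwidth `n`. -/
noncomputable def errorRate (n s : ℕ) (ρ κ α : ℝ) : ℝ :=
  ρ ^ 2 * (1 + Real.log (1 / α)) + remainder n n ρ s κ α

lemma remainder_self (n s : ℕ) (ρ κ α : ℝ) :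
    remainder n n ρ s κ α
      = ρ * Real.log ((n + n) / α) + ρ * κ * √(Real.log (16 / α)) + s := by
  rw [remainder, div_self (by positivity), mul_one]

lemma log_one_div_nonneg (hα : 0 < α) (hα1 : α < 1) : 0 ≤ Real.log (1 / α) :=
  Real.log_nonneg ((one_le_div hα).mpr hα1.le)

lemma log_sixteen_div_le (hα : 0 < α) (hα1 : α < 1) :
    Real.log (16 / α) ≤ 3 * (1 + Real.log (1 / α)) := by
  have : Real.log (16 / α) = 4 * Real.log 2 + Real.log (1 / α) := by
    rw [show 16 / α = 2 ^ 4 * (1 / α) by ring, Real.log_mul (by norm_num) (by positivity),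
      Real.log_pow]
    norm_num
  linarith [Real.log_two_lt_d9, log_one_div_nonneg hα hα1]

lemma log_two_pow_div_le (hα : 0 < α) (hα1 : α < 1) (s : ℕ) :
    Real.log (2 ^ s / (α / 8)) ≤ s + 3 * (1 + Real.log (1 / α)) := by
  have : Real.log (2 ^ s / (α / 8)) = (s + 3) * Real.log 2 + Real.log (1 / α) := by
    rw [show (2 : ℝ) ^ s / (α / 8) = 2 ^ (s + 3) * (1 / α) by field_simp; ring,
      Real.log_mul (by positivity) (by positivity), Real.log_pow]
    push_cast
    rfl
  nlinarith [Real.log_two_lt_d9, log_one_div_nonneg hα hα1, s.cast_nonneg (α := ℝ)]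

lemma log_add_div_eq (hn : n ≠ 0) (hα : 0 < α) :
    Real.log ((n + n) / α) = Real.log 2 + Real.log n + Real.log (1 / α) := by
  have : (0 : ℝ) < n := by positivity
  rw [← Real.log_mul (by positivity) (by positivity), ← Real.log_mul (by positivity)
    (by positivity), two_mul, mul_one_div]

lemma one_le_log_add_div (hn : 2 ≤ n) (hα : 0 < α) (hα1 : α < 1) :
    1 ≤ Real.log ((n + n) / α) := by
  have log_two_le : Real.log 2 ≤ Real.log n := Real.log_le_log two_pos (by exact_mod_cast hn)
  linarith [log_add_div_eq (show n ≠ 0 by lia) hα, Real.log_two_gt_d9, log_one_div_nonneg hα hα1]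

lemma log_mul_sq_div_le (hn : 2 ≤ n) (hα : 0 < α) (hα1 : α < 1) :
    Real.log (64 * (n + 1) ^ 2 / α) ≤ 5 * Real.log ((n + n) / α) := by
  have hn' : (2 : ℝ) ≤ n := by exact_mod_cast hn
  have log_two_le : Real.log 2 ≤ Real.log n := Real.log_le_log two_pos hn'
  have log_succ_le : Real.log (n + 1) ≤ Real.log 2 + Real.log n := by
    rw [← Real.log_mul (by positivity) (by positivity)]
    exact Real.log_le_log (by positivity) (by linarith)
  have : Real.log (64 * (n + 1) ^ 2 / α)
      = 6 * Real.log 2 + 2 * Real.log (n + 1) + Real.log (1 / α) := by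
    rw [show 64 * ((n : ℝ) + 1) ^ 2 / α = 2 ^ 6 * (n + 1) ^ 2 * (1 / α) by ring,
      Real.log_mul (by positivity) (by positivity), Real.log_mul (by positivity) (by positivity),
      Real.log_pow, Real.log_pow]
    norm_num
  linarith [log_add_div_eq (show n ≠ 0 by lia) hα, log_one_div_nonneg hα hα1]

end ErrorRate

section OracleFilter

variable {m n k : ℕ} {ρ σ : ℝ} {x φ : Signal} {a b : ℤ}

/-- The deterministic content of `Interpolable`: by the bias-variance decomposition, the
interpolating filter `φ` has small energy and reproduces the signal `x` up to a small bias. -/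
structure IsOracleFilter (σ : ℝ) (m n k : ℕ) (ρ : ℝ) (x φ : Signal) : Prop where
  one_le : 1 ≤ ρ
  le : k ≤ m
  supportedOn : SupportedOn (-(k : ℤ)) (m - k) φ
  energy_le : energy φ ≤ ρ / (2 * (m + 1))
  bias_le : ∀ t ∈ Finset.Icc (-(m : ℤ) - k) (n - k),
    ‖(x - conv φ x) t‖ ^ 2 ≤ ρ * σ ^ 2 / (m + 1)

lemma SupportedOn.integral_norm_sq_sub_conv_observe {Ω : Type*} [MeasurableSpace Ω]
    {P : Measure Ω} {ζ : ℤ → Ω → ℂ} (hζ : IsStdComplexNoise P ζ)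
    (hφ : SupportedOn a b φ) (t : ℤ) :
    ∫ ω, ‖x t - SignalDenoising.conv φ (observe x σ fun u => ζ u ω) t‖ ^ 2 ∂P
      = ‖(x - SignalDenoising.conv φ x) t‖ ^ 2 + 2 * (σ ^ 2 * energy φ) := by
  set U := Finset.Icc (t - b) (t - a)
  have path_measurable := hζ.measurable_path
  have law : P.map (restr U ∘ fun ω t => ζ t ω) = complexGaussian U := by
    rw [← Measure.map_map (measurable_restr U) path_measurable, hζ.map_path, map_restr_noiseLaw]
  have h := integral_norm_sq_add_inner ((x - SignalDenoising.conv φ x) t)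
    (-(σ : ℂ) • convForm U φ t)
  rw [← law, integral_map ((measurable_restr U).comp path_measurable).aemeasurable (by fun_prop),
    norm_smul, mul_pow, norm_convForm_sq, ← hφ.energy_eq_sum_sub subset_rfl, norm_neg,
    Complex.norm_real, Real.norm_eq_abs, sq_abs] at h
  rw [← h]
  congr with ω
  rw [hφ.conv_observe, inner_smul_left, Function.comp_apply,
    inner_convForm (U := U) (hφ.apply_sub_eq_zero subset_rfl)]
  simp only [Pi.add_apply, Pi.sub_apply, Pi.smul_apply, smul_eq_mul, map_neg, Complex.conj_ofReal]
  congr 2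
  ring

lemma Interpolable.exists_isOracleFilter {Ω : Type*} [MeasurableSpace Ω] {P : Measure Ω}
    {ζ : ℤ → Ω → ℂ} (hζ : IsStdComplexNoise P ζ) (hσ : 0 < σ)
    (h : Interpolable P ζ σ m n k ρ x) : ∃ φ, IsOracleFilter σ m n k ρ x φ := by
  obtain ⟨hρ, hk, φ, hφ, risk_le⟩ := h
  simp only [hφ.integral_norm_sq_sub_conv_observe hζ] at risk_le
  have variance_nonneg : 0 ≤ σ ^ 2 * energy φ := mul_nonneg (sq_nonneg σ) (energy_nonneg φ)
  refine ⟨φ, hρ, hk, hφ, ?_, fun t ht => ?_⟩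
  · have variance_le : 2 * (σ ^ 2 * energy φ) ≤ ρ * σ ^ 2 / (m + 1) :=
      (le_add_of_nonneg_left (sq_nonneg _)).trans (risk_le (-k) (by lia) (by lia))
    have hm : (0 : ℝ) < m + 1 := by positivity
    rw [le_div_iff₀ hm] at variance_le
    rw [le_div_iff₀ (by positivity)]
    refine le_of_mul_le_mul_right ?_ (pow_pos hσ 2)
    linarith
  · rw [Finset.mem_Icc] at ht
    linarith [risk_le t ht.1 ht.2]

namespace IsOracleFilter

variable {z : Signal} {t : ℤ}

lemma energy_le_div (h : IsOracleFilter σ m n k ρ x φ) (hn : n = 2 * m) :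
    energy φ ≤ ρ / (n + 1) := by
  have := h.one_le
  refine h.energy_le.trans (div_le_div_of_nonneg_left (by linarith) (by positivity) ?_)
  rw [hn]
  push_cast
  linarith

lemma two_mul_le (h : IsOracleFilter σ m n k ρ x φ) (hn : n = 2 * m) : 2 * k ≤ n := by
  have := h.le
  lia

lemma conv_self_mem_feasibleFilters (h : IsOracleFilter σ m n k ρ x φ) (hn : n = 2 * m) :
    conv φ φ ∈ feasibleFilters n (2 * k) (2 * ρ) := by
  have hk := h.le
  have supported_self : SupportedOn (-((2 * k : ℕ) : ℤ)) (n - (2 * k : ℕ)) φ :=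
    h.supportedOn.mono (by lia) (by lia)
  have supported_conv : SupportedOn (-((2 * k : ℕ) : ℤ)) (n - (2 * k : ℕ)) (conv φ φ) :=
    (h.supportedOn.supportedOn_conv h.supportedOn).mono (by lia) (by lia)
  refine ⟨supported_conv, ?_⟩
  rw [fourierL1Norm_shift_conv_self supported_self supported_conv, le_div_iff₀ (by positivity),
    mul_right_comm, Real.mul_self_sqrt (by positivity), ← le_div_iff₀' (by positivity)]
  refine (h.energy_le_div hn).trans ?_
  gcongr
  linarith [h.one_le]

lemma norm_sub_conv_conv_self_sq_le (h : IsOracleFilter σ m n k ρ x φ) (hn : n = 2 * m)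
    (ht : t ∈ fitWindow n (2 * k)) :
    ‖(x - conv (conv φ φ) x) t‖ ^ 2 ≤ 3 * ρ ^ 2 * σ ^ 2 / (m + 1) := by
  have hk := h.le
  have hρ := h.one_le
  rw [Finset.mem_Icc] at ht
  set u := x - conv φ x with hu
  have error_eq : x - conv (conv φ φ) x = u + conv φ u := by
    rw [hu, h.supportedOn.conv_sub, h.supportedOn.conv_assoc h.supportedOn]
    abel
  have bias : ‖u t‖ ^ 2 ≤ ρ * σ ^ 2 / (m + 1) := h.bias_le t (Finset.mem_Icc.mpr (by lia))
  have filtered_bias : ‖conv φ u t‖ ^ 2 ≤ ρ ^ 2 * σ ^ 2 / (2 * (m + 1)) := by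
    refine (h.supportedOn.norm_conv_sq_le_of_forall fun τ hτ => h.bias_le τ ?_).trans ?_
    · rw [Finset.mem_Icc] at hτ ⊢
      lia
    · rw [show ((m : ℤ) - k - -k + 1).toNat = m + 1 by lia]
      push_cast
      rw [mul_div_cancel₀ _ (by positivity)]
      calc _ ≤ ρ / (2 * (m + 1)) * (ρ * σ ^ 2) := by grw [h.energy_le]
        _ = _ := by ring
  have rho_le : ρ * σ ^ 2 / (m + 1) ≤ ρ ^ 2 * σ ^ 2 / (m + 1) := by
    gcongr
    nlinarith
  calc ‖(x - conv (conv φ φ) x) t‖ ^ 2 ≤ (‖u t‖ + ‖conv φ u t‖) ^ 2 := by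
        rw [error_eq]
        exact pow_le_pow_left₀ (norm_nonneg _) (norm_add_le _ _) 2
    _ ≤ 2 * (‖u t‖ ^ 2 + ‖conv φ u t‖ ^ 2) := add_sq_le
    _ ≤ 2 * (ρ ^ 2 * σ ^ 2 / (m + 1) + ρ ^ 2 * σ ^ 2 / (2 * (m + 1))) := by
        grw [bias, filtered_bias, rho_le]
    _ = 3 * ρ ^ 2 * σ ^ 2 / (m + 1) := by field_simp; ring

lemma sum_norm_sub_conv_conv_self_sq_le (h : IsOracleFilter σ m n k ρ x φ) (hn : n = 2 * m) :
    ∑ t ∈ fitWindow n (2 * k), ‖(x - conv (conv φ φ) x) t‖ ^ 2 ≤ 6 * ρ ^ 2 * σ ^ 2 := by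
  calc _ ≤ ((n : ℝ) + 1) * (3 * ρ ^ 2 * σ ^ 2 / (m + 1)) := by
        refine (Finset.sum_le_card_nsmul _ _ _ fun t ht =>
          h.norm_sub_conv_conv_self_sq_le hn ht).trans_eq ?_
        rw [card_fitWindow, nsmul_eq_mul, Nat.cast_succ]
    _ ≤ (2 * ((m : ℝ) + 1)) * (3 * ρ ^ 2 * σ ^ 2 / (m + 1)) := by
        gcongr
        rw [hn]
        push_cast
        linarith
    _ = 6 * ρ ^ 2 * σ ^ 2 := by field_simp; ring

end IsOracleFilter

end OracleFilter

section LeastSquaresRisk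

variable {n k : ℕ} {S : Submodule ℂ Signal} {φ ψ φhat x xS ε z : Signal} {T : Finset ℤ}
  {r σ V B α : ℝ}

lemma l2Norm_shift_sq (n k : ℕ) (u : Signal) :
    l2Norm n (shift k u) ^ 2 = ∑ t ∈ fitWindow n k, ‖u t‖ ^ 2 := by
  rw [l2Norm, Real.sq_sqrt (Finset.sum_nonneg fun _ _ => sq_nonneg _),
    ← sum_range_sub_eq_sum_fitWindow]
  rfl

lemma l2Norm_shift (hk : k ≤ n) (u : Signal) :
    l2Norm n (shift k u) = ‖window (noiseWindow n) (fitWindow n k) u‖ := by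
  have l2Norm_nonneg : 0 ≤ l2Norm n (shift k u) := Real.sqrt_nonneg _
  rw [← sq_eq_sq₀ l2Norm_nonneg (norm_nonneg _), l2Norm_shift_sq,
    norm_window_sq (fitWindow_subset_noiseWindow hk)]

lemma norm_windowResidual_shift_le (hk : k ≤ n)
    (hε : ∀ τ : ℕ, τ ≤ n → l2Norm n (shift τ ε) ≤ B) {τ : ℤ} (hτ : τ ∈ fitWindow n k) :
    ‖windowResidual (noiseWindow n) (fitWindow n k) S (shift τ ε)‖ ≤ B := by
  rw [Finset.mem_Icc] at hτ
  refine (norm_windowResidual_le _).trans ?_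
  rw [← l2Norm_shift hk, shift_shift, ← Int.toNat_of_nonneg (show 0 ≤ k + τ by lia)]
  exact hε _ (by lia)

namespace GoodNoise

lemma norm_noiseCorrelation_bias_le (hz : GoodNoise n k S φ ε T V B α z) (hB : 0 ≤ B) :
    ‖noiseCorrelation (noiseWindow n) (fitWindow n k) S z ε‖ ≤ 2 * B * √(Real.log (16 / α)) := by
  refine (Real.le_sqrt_of_sq_le hz.bias).trans_eq ?_
  rw [show 4 * B ^ 2 = (2 * B) ^ 2 by ring, Real.sqrt_mul (sq_nonneg _),
    Real.sqrt_sq (by positivity)]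

lemma norm_noiseCorrelation_conv_bias_le (hz : GoodNoise n k S φ ε T V B α z) (hB : 0 ≤ B)
    (hr : 0 ≤ r) (hψ : ψ ∈ feasibleFilters n k r) :
    ‖noiseCorrelation (noiseWindow n) (fitWindow n k) S z (conv ψ ε)‖
      ≤ 2 * r * B * √(Real.log (16 / α)) := by
  have expansion : noiseCorrelation (noiseWindow n) (fitWindow n k) S z (conv ψ ε)
      = ∑ τ ∈ fitWindow n k,
        ψ τ * noiseCorrelation (noiseWindow n) (fitWindow n k) S z (shift τ ε) := by
    rw [hψ.1.conv_eq_sum_shift, map_sum]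
    simp only [map_smul, smul_eq_mul]
  have sq_le : ‖noiseCorrelation (noiseWindow n) (fitWindow n k) S z (conv ψ ε)‖ ^ 2
      ≤ (2 * r * B) ^ 2 * Real.log (16 / α) := by
    calc _ ≤ (∑ τ ∈ fitWindow n k, ‖ψ τ‖
          * ‖noiseCorrelation (noiseWindow n) (fitWindow n k) S z (shift τ ε)‖) ^ 2 := by
          rw [expansion]
          simp only [← norm_mul]
          exact pow_le_pow_left₀ (norm_nonneg _) (norm_sum_le _ _) 2
      _ ≤ energy ψ * (4 * ((n + 1) * B ^ 2) * Real.log (16 / α)) := by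
          rw [hψ.1.energy_eq_sum]
          exact (Finset.sum_mul_sq_le_sq_mul_sq _ _ _).trans
            (mul_le_mul_of_nonneg_left hz.shifted_bias (by positivity))
      _ ≤ r ^ 2 / (n + 1) * (4 * ((n + 1) * B ^ 2) * Real.log (16 / α)) := by
          refine mul_le_mul_of_nonneg_right (energy_le_of_mem_feasibleFilters hψ) ?_
          exact (Finset.sum_nonneg fun _ _ => sq_nonneg _).trans hz.shifted_bias
      _ = (2 * r * B) ^ 2 * Real.log (16 / α) := by field_simp; ring
  refine (Real.le_sqrt_of_sq_le sq_le).trans_eq ?_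
  rw [Real.sqrt_mul (sq_nonneg _), Real.sqrt_sq (by positivity)]

lemma norm_noiseCorrelation_conv_noise_le (hz : GoodNoise n k S φ ε T V B α z)
    (hψ : ψ ∈ feasibleFilters n k r) :
    ‖noiseCorrelation (noiseWindow n) (fitWindow n k) S z (conv ψ z)‖
      ≤ 2 * r * (√8 * Real.log (64 * (n + 1) ^ 2 / α)
        + 2 * (1 + √(Module.finrank ℂ S))) := by
  refine (norm_apply_conv_le_of_mem_feasibleFilters hψ _ hz.atom_correlation).trans_eq ?_
  rw [Real.sqrt_mul (by norm_num)]
  field_simp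

lemma norm_noiseCorrelation_error_le (hz : GoodNoise n k S φ ε T V B α z) (hB : 0 ≤ B)
    (hσ : 0 ≤ σ) (hr : 0 ≤ r) (hS : ∀ τ : ℤ, shift τ xS ∈ S) (hψ : ψ ∈ feasibleFilters n k r) :
    ‖noiseCorrelation (noiseWindow n) (fitWindow n k) S z
        (xS + ε - conv ψ (observe (xS + ε) σ z))‖
      ≤ 2 * (1 + r) * B * √(Real.log (16 / α))
        + σ * (2 * r * (√8 * Real.log (64 * (n + 1) ^ 2 / α)
          + 2 * (1 + √(Module.finrank ℂ S)))) := by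
  set corr := noiseCorrelation (noiseWindow n) (fitWindow n k) S z with corr_eq
  have corr_eq_zero {v : Signal} (hv : v ∈ S) : corr v = 0 := by
    rw [corr_eq, noiseCorrelation_apply, windowResidual_eq_zero hv, inner_zero_right]
  have xS_mem : xS ∈ S := by simpa only [shift_zero] using hS 0
  have split : corr (xS + ε - conv ψ (observe (xS + ε) σ z))
      = corr ε - corr (conv ψ ε) - σ * corr (conv ψ z) := by
    rw [hψ.1.conv_observe, hψ.1.conv_add]
    simp only [map_sub, map_add, map_smul, corr_eq_zero xS_mem, corr_eq_zero (hψ.1.conv_mem hS),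
      smul_eq_mul]
    ring
  calc _ ≤ ‖corr ε‖ + ‖corr (conv ψ ε)‖ + σ * ‖corr (conv ψ z)‖ := by
        rw [split]
        refine (norm_sub_le _ _).trans (add_le_add (norm_sub_le _ _) (le_of_eq ?_))
        rw [norm_mul, Complex.norm_real, Real.norm_of_nonneg hσ]
    _ ≤ 2 * B * √(Real.log (16 / α)) + 2 * r * B * √(Real.log (16 / α)) + σ * _ := by
        grw [hz.norm_noiseCorrelation_bias_le hB, hz.norm_noiseCorrelation_conv_bias_le hB hr hψ,
          hz.norm_noiseCorrelation_conv_noise_le hψ]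
    _ = _ := by ring

end GoodNoise

lemma IsInterpolatingLS.l2Norm_error_sq_le
    (hLS : IsInterpolatingLS n k r (observe x σ z) φhat) (hk : k ≤ n) (hσ : 0 ≤ σ)
    (hψ : ψ ∈ feasibleFilters n k r) {R : ℝ}
    (hR : ∀ χ ∈ feasibleFilters n k r, ‖noiseCorrelation (noiseWindow n) (fitWindow n k) S z
      (x - conv χ (observe x σ z))‖ ≤ R) :
    l2Norm n (shift k (x - conv φhat (observe x σ z))) ^ 2
      ≤ 4 * l2Norm n (shift k (x - conv ψ (observe x σ z))) ^ 2
        + 6 * σ ^ 2 * ‖(windowSpace (noiseWindow n) (fitWindow n k) S).starProjection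
          (window (noiseWindow n) (fitWindow n k) z)‖ ^ 2
        + 8 * σ * R := by
  set y := observe x σ z
  have residual_eq (χ : Signal) : l2Norm n (shift k (y - conv χ y))
      = ‖window (noiseWindow n) (fitWindow n k) (x - conv χ y)
        + (σ : ℂ) • window (noiseWindow n) (fitWindow n k) z‖ := by
    rw [l2Norm_shift hk, ← map_smul, ← map_add, sub_add_eq_add_sub]
    rfl
  have optimal := hLS.2 ψ hψ
  rw [residual_eq, residual_eq] at optimal
  have basic := norm_sq_le_of_norm_add_smul_sq_le
    (windowSpace (noiseWindow n) (fitWindow n k) S) hσ optimal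
  simp only [inner_starProjection_orthogonal_window, ← noiseCorrelation_apply,
    ← l2Norm_shift hk] at basic
  grw [hR φhat hLS.1, hR ψ hψ] at basic
  linarith

end LeastSquaresRisk

section RiskBounds

variable {m n k : ℕ} {S : Submodule ℂ Signal} {φ φhat ψ x xS ε z : Signal}
  {ρ κ σ α : ℝ} {t : ℤ}

lemma norm_ofReal_mul_sq (σ : ℝ) (c : ℂ) : ‖(σ : ℂ) * c‖ ^ 2 = σ ^ 2 * ‖c‖ ^ 2 := by
  rw [norm_mul, mul_pow, Complex.norm_real, Real.norm_eq_abs, sq_abs]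

lemma norm_sub_sq_le_two_mul {E : Type*} [SeminormedAddCommGroup E] (a b : E) :
    ‖a - b‖ ^ 2 ≤ 2 * (‖a‖ ^ 2 + ‖b‖ ^ 2) :=
  (pow_le_pow_left₀ (norm_nonneg _) (norm_sub_le a b) 2).trans add_sq_le

namespace IsOracleFilter

lemma sum_norm_conv_conv_self_sq_le (h : IsOracleFilter σ m n k ρ x φ) (hn : n = 2 * m)
    (v : Signal) :
    ∑ t ∈ fitWindow n (2 * k), ‖conv (conv φ φ) v t‖ ^ 2
      ≤ ρ * ∑ u ∈ Finset.Icc (-(m : ℤ) - k) (n - k), ‖conv φ v u‖ ^ 2 := by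
  have pointwise (t : ℤ) (ht : t ∈ fitWindow n (2 * k)) : ‖conv (conv φ φ) v t‖ ^ 2
      ≤ energy φ * ∑ u ∈ Finset.Icc (-(m : ℤ) - k) (n - k), ‖conv φ v u‖ ^ 2 := by
    rw [h.supportedOn.conv_assoc h.supportedOn]
    rw [Finset.mem_Icc] at ht
    exact h.supportedOn.norm_conv_sq_le _ (Finset.Icc_subset_Icc (by lia) (by lia))
  calc _ ≤ ((n : ℝ) + 1)
        * (energy φ * ∑ u ∈ Finset.Icc (-(m : ℤ) - k) (n - k), ‖conv φ v u‖ ^ 2) := by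
        refine (Finset.sum_le_card_nsmul _ _ _ pointwise).trans_eq ?_
        rw [card_fitWindow, nsmul_eq_mul, Nat.cast_succ]
    _ ≤ ((n : ℝ) + 1)
        * (ρ / (n + 1) * ∑ u ∈ Finset.Icc (-(m : ℤ) - k) (n - k), ‖conv φ v u‖ ^ 2) := by
        grw [h.energy_le_div hn]
    _ = _ := by field_simp

lemma l2Norm_error_sq_le (h : IsOracleFilter σ m n k ρ x φ) (hn : n = 2 * m) (z : Signal) :
    l2Norm n (shift ((2 * k : ℕ) : ℤ) (x - conv (conv φ φ) (observe x σ z))) ^ 2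
      ≤ 12 * ρ ^ 2 * σ ^ 2
        + 2 * σ ^ 2 * (ρ * ∑ u ∈ Finset.Icc (-(m : ℤ) - k) (n - k), ‖conv φ z u‖ ^ 2) := by
  have error_eq (t : ℤ) : (x - conv (conv φ φ) (observe x σ z)) t
      = (x - conv (conv φ φ) x) t - σ * conv (conv φ φ) z t := by
    rw [(h.supportedOn.supportedOn_conv h.supportedOn).conv_observe, ← sub_sub]
    rfl
  calc _ = ∑ t ∈ fitWindow n (2 * k),
        ‖(x - conv (conv φ φ) x) t - σ * conv (conv φ φ) z t‖ ^ 2 := by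
        rw [l2Norm_shift_sq]
        simp only [error_eq]
    _ ≤ ∑ t ∈ fitWindow n (2 * k),
        2 * (‖(x - conv (conv φ φ) x) t‖ ^ 2 + σ ^ 2 * ‖conv (conv φ φ) z t‖ ^ 2) := by
        gcongr with t
        rw [← norm_ofReal_mul_sq]
        exact norm_sub_sq_le_two_mul _ _
    _ = 2 * (∑ t ∈ fitWindow n (2 * k), ‖(x - conv (conv φ φ) x) t‖ ^ 2
        + σ ^ 2 * ∑ t ∈ fitWindow n (2 * k), ‖conv (conv φ φ) z t‖ ^ 2) := by
        rw [← Finset.mul_sum, Finset.sum_add_distrib, Finset.mul_sum _ _ (σ ^ 2)]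
    _ ≤ 2 * (6 * ρ ^ 2 * σ ^ 2 + σ ^ 2
        * (ρ * ∑ u ∈ Finset.Icc (-(m : ℤ) - k) (n - k), ‖conv φ z u‖ ^ 2)) := by
        grw [h.sum_norm_sub_conv_conv_self_sq_le hn, h.sum_norm_conv_conv_self_sq_le hn]
    _ = _ := by ring

end IsOracleFilter

lemma GoodNoise.sum_norm_conv_oracle_sq_le {T : Finset ℤ} {B : ℝ}
    (hz : GoodNoise n k S φ ε T (3 / 2 * ρ) B α z) (hρ : 0 ≤ ρ) (hα : 0 < α) (hα1 : α < 1) :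
    ∑ t ∈ T, ‖conv φ z t‖ ^ 2 ≤ 18 * ρ * (1 + Real.log (1 / α)) := by
  calc _ ≤ 4 * (3 / 2 * ρ) * Real.log (16 / α) := hz.oracle
    _ ≤ 4 * (3 / 2 * ρ) * (3 * (1 + Real.log (1 / α))) := by grw [log_sixteen_div_le hα hα1]
    _ = _ := by ring

lemma GoodNoise.norm_noiseCorrelation_error_le_remainder {T : Finset ℤ} {V : ℝ}
    (hz : GoodNoise n k S φ ε T V (κ * σ) α z) (hn : 2 ≤ n) (hρ : 1 ≤ ρ) (hκ : 0 ≤ κ)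
    (hσ : 0 ≤ σ) (hα : 0 < α) (hα1 : α < 1) (hS : ∀ τ : ℤ, shift τ xS ∈ S)
    (hψ : ψ ∈ feasibleFilters n k (2 * ρ)) :
    ‖noiseCorrelation (noiseWindow n) (fitWindow n k) S z
        (xS + ε - conv ψ (observe (xS + ε) σ z))‖
      ≤ σ * (12 * ρ ^ 2 + 60 * remainder n n ρ (Module.finrank ℂ S) κ α) := by
  have error_le := hz.norm_noiseCorrelation_error_le (mul_nonneg hκ hσ) hσ
    (by positivity : 0 ≤ 2 * ρ) hS hψ
  have sqrt_eight_le : √8 ≤ 3 := Real.sqrt_le_iff.mpr (by norm_num)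
  have l_ge := one_le_log_add_div hn hα hα1
  grw [log_mul_sq_div_le hn hα hα1, sqrt_eight_le] at error_le
  refine error_le.trans ?_
  rw [remainder_self]
  set l := Real.log ((n + n) / α)
  set K := √(Real.log (16 / α))
  set s : ℝ := (Module.finrank ℂ S : ℝ)
  have sqrt_s_sq : √s ^ 2 = s := Real.sq_sqrt (Nat.cast_nonneg _)
  have deviation : (2 + 4 * ρ) * (κ * K) ≤ 6 * ρ * (κ * K) :=
    mul_le_mul_of_nonneg_right (by linarith) (by positivity)
  have deviation_nonneg : 0 ≤ ρ * (κ * K) := by positivity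
  have cross : 8 * (ρ * √s) ≤ 4 * ρ ^ 2 + 4 * √s ^ 2 := by nlinarith [sq_nonneg (ρ - √s)]
  have rho_le : ρ ≤ ρ ^ 2 := le_self_pow₀ hρ two_ne_zero
  calc _ = σ * ((2 + 4 * ρ) * (κ * K) + 60 * (ρ * l) + 8 * ρ + 8 * (ρ * √s)) := by ring
    _ ≤ _ := mul_le_mul_of_nonneg_left (by linarith [sq_nonneg √s]) hσ

lemma GoodNoise.l2Norm_error_sq_le
    (hz : GoodNoise n (2 * k) S φ ε (Finset.Icc (-(m : ℤ) - k) (n - k)) (3 / 2 * ρ) (κ * σ) α z)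
    (hφ : IsOracleFilter σ m n k ρ (xS + ε) φ) (hm : 1 ≤ m) (hn : n = 2 * m) (hκ : 0 ≤ κ)
    (hσ : 0 ≤ σ) (hα : 0 < α) (hα1 : α < 1) (hS : ∀ τ : ℤ, shift τ xS ∈ S)
    (hLS : IsInterpolatingLS n (2 * k) (2 * ρ) (observe (xS + ε) σ z) φhat) :
    l2Norm n (shift ((2 * k : ℕ) : ℤ) (xS + ε - conv φhat (observe (xS + ε) σ z))) ^ 2
      ≤ 504 * (σ ^ 2 * errorRate n (Module.finrank ℂ S) ρ κ α) := by
  have hρ := hφ.one_le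
  have basic := hLS.l2Norm_error_sq_le (hφ.two_mul_le hn) hσ (hφ.conv_self_mem_feasibleFilters hn)
    fun χ hχ => hz.norm_noiseCorrelation_error_le_remainder (by lia) hρ hκ hσ hα hα1 hS hχ
  grw [hφ.l2Norm_error_sq_le hn, hz.sum_norm_conv_oracle_sq_le (by linarith) hα hα1,
    hz.projection, log_two_pow_div_le hα hα1] at basic
  have s_le : (Module.finrank ℂ S : ℝ) ≤ remainder n n ρ (Module.finrank ℂ S) κ α := by
    have := one_le_log_add_div (n := n) (by lia) hα hα1
    rw [remainder_self]
    exact le_add_of_nonneg_left (by positivity)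
  have L_ge : 1 ≤ 1 + Real.log (1 / α) := le_add_of_nonneg_right (log_one_div_nonneg hα hα1)
  have rho_sq_le := le_mul_of_one_le_right (sq_nonneg ρ) L_ge
  have L_le := le_mul_of_one_le_left (zero_le_one.trans L_ge) (one_le_pow₀ hρ (n := 2))
  refine basic.trans ?_
  rw [errorRate]
  set L := 1 + Real.log (1 / α)
  set E := remainder n n ρ (Module.finrank ℂ S) κ α
  calc _ = σ ^ 2 * (144 * ρ ^ 2 + 144 * (ρ ^ 2 * L) + 72 * L + 24 * Module.finrank ℂ S
        + 480 * E) := by ring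
    _ ≤ σ ^ 2 * (504 * (ρ ^ 2 * L + E)) :=
        mul_le_mul_of_nonneg_left (by linarith) (sq_nonneg σ)
    _ = _ := by ring

end RiskBounds

section Pointwise

variable {m n k s : ℕ} {S : Submodule ℂ Signal} {φ φhat ψ x ε z : Signal}
  {ρ κ σ α : ℝ} {a b c d t : ℤ}

lemma sq_mul_le_errorRate (hn : 2 ≤ n) (hρ : 0 ≤ ρ) (hκ : 0 ≤ κ) (hα : 0 < α) (hα1 : α < 1) :
    ρ ^ 2 * (1 + Real.log (1 / α)) ≤ errorRate n s ρ κ α := by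
  have := one_le_log_add_div hn hα hα1
  rw [errorRate, remainder_self]
  exact le_add_of_nonneg_right (by positivity)

lemma errorRate_nonneg (hn : 2 ≤ n) (hρ : 0 ≤ ρ) (hκ : 0 ≤ κ) (hα : 0 < α) (hα1 : α < 1) :
    0 ≤ errorRate n s ρ κ α := by
  have := log_one_div_nonneg hα hα1
  exact (by positivity : 0 ≤ ρ ^ 2 * (1 + Real.log (1 / α))).trans
    (sq_mul_le_errorRate hn hρ hκ hα hα1)

lemma mul_log_le_errorRate (hρ : 0 ≤ ρ) (hκ : 0 ≤ κ) (hα : 0 < α) (hα1 : α < 1) :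
    ρ * Real.log ((n + n) / α) ≤ errorRate n s ρ κ α := by
  have := log_one_div_nonneg hα hα1
  have : 0 ≤ ρ ^ 2 * (1 + Real.log (1 / α)) + ρ * κ * √(Real.log (16 / α)) + s := by positivity
  rw [errorRate, remainder_self]
  linarith

lemma norm_sq_le_of_eq_add_add_sub_add {E : Type*} [SeminormedAddCommGroup E] {v a b c d : E}
    (h : v = a + b - c + d) :
    ‖v‖ ^ 2 ≤ 4 * (‖a‖ ^ 2 + ‖b‖ ^ 2 + ‖c‖ ^ 2 + ‖d‖ ^ 2) := by
  calc ‖v‖ ^ 2 ≤ (‖a + b‖ + ‖c - d‖) ^ 2 := by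
        rw [h, sub_add]
        exact pow_le_pow_left₀ (norm_nonneg _) (norm_sub_le _ _) 2
    _ ≤ 2 * (‖a + b‖ ^ 2 + ‖c - d‖ ^ 2) := add_sq_le
    _ ≤ 2 * (2 * (‖a‖ ^ 2 + ‖b‖ ^ 2) + 2 * (‖c‖ ^ 2 + ‖d‖ ^ 2)) := by
        grw [← norm_sub_sq_le_two_mul c d, ← norm_neg b, ← norm_sub_sq_le_two_mul a, sub_neg_eq_add]
    _ = _ := by ring

/-- Filtering the error by `φ` makes it controllable by the `ℓ₂`-risk; in the rest, the operator
`1 - φ` hits the signal, which `φ` reproduces, or the noise, which `ψ` averages out. -/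
lemma SupportedOn.sub_conv_observe_eq (hφ : SupportedOn a b φ) (hψ : SupportedOn c d ψ)
    (x z : Signal) (σ : ℝ) :
    x - SignalDenoising.conv ψ (observe x σ z)
      = SignalDenoising.conv φ (x - SignalDenoising.conv ψ (observe x σ z))
        + ((x - SignalDenoising.conv φ x) - SignalDenoising.conv ψ (x - SignalDenoising.conv φ x))
        - (σ : ℂ) • SignalDenoising.conv ψ z
        + (σ : ℂ) • SignalDenoising.conv ψ (SignalDenoising.conv φ z) := by
  rw [hψ.conv_observe, hφ.conv_sub, hφ.conv_add, hφ.conv_smul, hψ.conv_sub, hφ.conv_left_comm hψ,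
    hφ.conv_left_comm hψ]
  abel

namespace IsOracleFilter

lemma norm_conv_sq_le (h : IsOracleFilter σ m n k ρ x φ) (hn : n = 2 * m)
    (ht : t ∈ Finset.Icc ((m : ℤ) - 3 * k) (n - 3 * k)) (v : Signal) :
    ‖conv φ v t‖ ^ 2 ≤ ρ / (n + 1) * l2Norm n (shift ((2 * k : ℕ) : ℤ) v) ^ 2 := by
  rw [Finset.mem_Icc] at ht
  have window_subset : Finset.Icc (t - (m - k)) (t - -k) ⊆ fitWindow n (2 * k) :=
    Finset.Icc_subset_Icc (by lia) (by lia)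
  grw [l2Norm_shift_sq, h.supportedOn.norm_conv_sq_le v window_subset, h.energy_le_div hn]

lemma norm_bias_sub_conv_bias_sq_le (h : IsOracleFilter σ m n k ρ x φ) (hn : n = 2 * m)
    (hψ : ψ ∈ feasibleFilters n (2 * k) (2 * ρ))
    (ht : t ∈ Finset.Icc ((m : ℤ) - 3 * k) (n - 3 * k)) :
    ‖((x - conv φ x) - conv ψ (x - conv φ x)) t‖ ^ 2 ≤ 20 * (σ ^ 2 * ρ / (n + 1) * ρ ^ 2) := by
  have hk := h.le
  have hρ := h.one_le
  rw [Finset.mem_Icc] at ht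
  have bias_le (τ : ℤ) (hτ : τ ∈ Finset.Icc (-(m : ℤ) - k) (n - k)) :
      ‖(x - conv φ x) τ‖ ^ 2 ≤ 2 * (σ ^ 2 * ρ / (n + 1)) := by
    refine (h.bias_le τ hτ).trans ?_
    rw [← mul_div_assoc, div_le_div_iff₀ (by positivity) (by positivity), hn]
    push_cast
    nlinarith [mul_nonneg (zero_le_one.trans hρ) (sq_nonneg σ)]
  have filtered_bias_le : ‖conv ψ (x - conv φ x) t‖ ^ 2 ≤ 8 * (σ ^ 2 * ρ / (n + 1) * ρ ^ 2) := by
    refine (hψ.1.norm_conv_sq_le_of_forall fun τ hτ => bias_le τ ?_).trans ?_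
    · rw [Finset.mem_Icc] at hτ ⊢
      lia
    · rw [show ((n : ℤ) - (2 * k : ℕ) - -(2 * k : ℕ) + 1).toNat = n + 1 by lia]
      push_cast
      grw [energy_le_of_mem_feasibleFilters hψ]
      exact le_of_eq (by field_simp; ring)
  calc _ ≤ 2 * (‖(x - conv φ x) t‖ ^ 2 + ‖conv ψ (x - conv φ x) t‖ ^ 2) :=
        norm_sub_sq_le_two_mul _ _
    _ ≤ 2 * (2 * (σ ^ 2 * ρ / (n + 1) * ρ ^ 2) + 8 * (σ ^ 2 * ρ / (n + 1) * ρ ^ 2)) := by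
        gcongr
        refine (bias_le t (Finset.mem_Icc.mpr (by lia))).trans ?_
        gcongr
        exact le_mul_of_one_le_right (by positivity) (one_le_pow₀ hρ)
    _ = _ := by ring

end IsOracleFilter

lemma GoodNoise.norm_conv_sq_le {T : Finset ℤ} {V B : ℝ} (hz : GoodNoise n k S φ ε T V B α z)
    (hn : 2 ≤ n) (hα : 0 < α) (hα1 : α < 1) (hψ : ψ ∈ feasibleFilters n k (2 * ρ))
    (ht : t ∈ fitWindow n k) :
    ‖conv ψ z t‖ ^ 2 ≤ 80 * (ρ / (n + 1) * (ρ * Real.log ((n + n) / α))) := by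
  have log_nonneg := zero_le_one.trans (one_le_log_add_div hn hα hα1)
  have atom_le (j : ℕ) (hj : j ∈ Finset.range (n + 1)) :
      ‖LinearMap.proj (R := ℂ) (φ := fun _ => ℂ) t (conv (atom n k j) z)‖
        ≤ √(20 * Real.log ((n + n) / α)) := by
    refine Real.le_sqrt_of_sq_le ((hz.atom_conv t ht j hj).trans ?_)
    linarith [log_mul_sq_div_le hn hα hα1]
  have bound := norm_apply_conv_le_of_mem_feasibleFilters hψ (LinearMap.proj t) atom_le
  calc _ ≤ (2 * ρ / √(n + 1) * √(20 * Real.log ((n + n) / α))) ^ 2 :=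
        pow_le_pow_left₀ (norm_nonneg _) bound 2
    _ = _ := by
        rw [mul_pow, div_pow, Real.sq_sqrt (by positivity), Real.sq_sqrt (by positivity)]
        ring

lemma GoodNoise.norm_conv_conv_oracle_sq_le {B : ℝ}
    (hz : GoodNoise n (2 * k) S φ ε (Finset.Icc (-(m : ℤ) - k) (n - k)) (3 / 2 * ρ) B α z)
    (hn : n = 2 * m) (hρ : 0 ≤ ρ) (hα : 0 < α) (hα1 : α < 1)
    (hψ : ψ ∈ feasibleFilters n (2 * k) (2 * ρ))
    (ht : t ∈ Finset.Icc ((m : ℤ) - 3 * k) (n - 3 * k)) :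
    ‖conv ψ (conv φ z) t‖ ^ 2 ≤ 72 * (ρ / (n + 1) * (ρ ^ 2 * (1 + Real.log (1 / α)))) := by
  rw [Finset.mem_Icc] at ht
  have window_subset : Finset.Icc (t - (n - (2 * k : ℕ))) (t - -(2 * k : ℕ))
      ⊆ Finset.Icc (-(m : ℤ) - k) (n - k) := Finset.Icc_subset_Icc (by lia) (by lia)
  calc _ ≤ energy ψ * ∑ u ∈ Finset.Icc (-(m : ℤ) - k) (n - k), ‖conv φ z u‖ ^ 2 :=
        hψ.1.norm_conv_sq_le _ window_subset
    _ ≤ (2 * ρ) ^ 2 / (n + 1) * (18 * ρ * (1 + Real.log (1 / α))) := by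
        grw [energy_le_of_mem_feasibleFilters hψ, hz.sum_norm_conv_oracle_sq_le hρ hα hα1]
    _ = _ := by ring

lemma GoodNoise.norm_error_apply_sq_le {B : ℝ}
    (hz : GoodNoise n (2 * k) S φ ε (Finset.Icc (-(m : ℤ) - k) (n - k)) (3 / 2 * ρ) B α z)
    (hφ : IsOracleFilter σ m n k ρ x φ) (hm : 1 ≤ m) (hn : n = 2 * m) (hκ : 0 ≤ κ)
    (hα : 0 < α) (hα1 : α < 1) (hψ : ψ ∈ feasibleFilters n (2 * k) (2 * ρ))
    (l2Norm_le : l2Norm n (shift ((2 * k : ℕ) : ℤ) (x - conv ψ (observe x σ z))) ^ 2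
      ≤ 504 * (σ ^ 2 * errorRate n s ρ κ α))
    (ht : t ∈ Finset.Icc ((m : ℤ) - 3 * k) (n - 3 * k)) :
    ‖x t - conv ψ (observe x σ z) t‖ ^ 2
      ≤ 2704 * (σ ^ 2 * ρ / (n + 1) * errorRate n s ρ κ α) := by
  have hρ := zero_le_one.trans hφ.one_le
  have t_mem : t ∈ fitWindow n (2 * k) := by
    have := hφ.le
    rw [Finset.mem_Icc] at ht ⊢
    lia
  have rho_sq_mul_le := sq_mul_le_errorRate (n := n) (s := s) (by lia) hρ hκ hα hα1
  have rho_sq_le : ρ ^ 2 ≤ errorRate n s ρ κ α := le_trans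
    (le_mul_of_one_le_right (sq_nonneg ρ) (le_add_of_nonneg_right (log_one_div_nonneg hα hα1)))
    rho_sq_mul_le
  have rho_log_le := mul_log_le_errorRate (n := n) (s := s) hρ hκ hα hα1
  have decomposition :=
    norm_sq_le_of_eq_add_add_sub_add (congrFun (hφ.supportedOn.sub_conv_observe_eq hψ.1 x z σ) t)
  simp only [Pi.smul_apply, smul_eq_mul, norm_ofReal_mul_sq] at decomposition
  grw [hφ.norm_conv_sq_le hn ht, l2Norm_le, hφ.norm_bias_sub_conv_bias_sq_le hn hψ ht,
    hz.norm_conv_sq_le (by lia) hα hα1 hψ t_mem,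
    hz.norm_conv_conv_oracle_sq_le hn hρ hα hα1 hψ ht, rho_log_le, rho_sq_mul_le, rho_sq_le]
    at decomposition
  exact decomposition.trans_eq (by ring)

end Pointwise

section GoodEvent

variable {Ω : Type*} [MeasurableSpace Ω] {P : Measure Ω}
  {ζ : ℤ → Ω → ℂ} {m n k : ℕ} {S : Submodule ℂ Signal} {φ x ε : Signal} {ρ B σ α : ℝ}

lemma IsOracleFilter.card_mul_energy_le (h : IsOracleFilter σ m n k ρ x φ) (hn : n = 2 * m) :
    (Finset.Icc (-(m : ℤ) - k) (n - k)).card * energy φ ≤ 3 / 2 * ρ := by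
  have hρ := h.one_le
  rw [Int.card_Icc, show ((n : ℤ) - k + 1 - (-m - k)).toNat = 3 * m + 1 by lia]
  push_cast
  calc _ ≤ (3 * (m : ℝ) + 1) * (ρ / (2 * (m + 1))) := by grw [h.energy_le]
    _ ≤ (3 * ((m : ℝ) + 1)) * (ρ / (2 * (m + 1))) := by
        gcongr
        linarith
    _ = _ := by field_simp

lemma IsOracleFilter.exists_goodNoise [FiniteDimensional ℂ S] (hζ : IsStdComplexNoise P ζ)
    (h : IsOracleFilter σ m n k ρ x φ) (hn : n = 2 * m)
    (hε : ∀ τ : ℕ, τ ≤ n → l2Norm n (shift τ ε) ≤ B) (hα : 0 < α) :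
    ∃ Ξ ⊆ {z | GoodNoise n (2 * k) S φ ε (Finset.Icc (-(m : ℤ) - k) (n - k)) (3 / 2 * ρ) B α z},
      MeasurableSet Ξ ∧ ENNReal.ofReal (1 - α) ≤ P {ω | (fun t => ζ t ω) ∈ Ξ} := by
  have hk := h.two_mul_le hn
  have tail := noiseLaw_not_goodNoise_le (S := S) hk h.supportedOn (h.card_mul_energy_le hn)
    (fun τ hτ => pow_le_pow_left₀ (norm_nonneg _) (norm_windowResidual_shift_le hk hε hτ) 2) hα
  obtain ⟨Ξ, subset, measurable, mass_le⟩ :=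
    exists_measurableSet_subset_of_measure_compl_le hα.le tail
  refine ⟨Ξ, subset, measurable, ?_⟩
  rwa [← hζ.map_path, Measure.map_apply hζ.measurable_path measurable] at mass_le

end GoodEvent

end SignalDenoising

theorem mainTheorem10 :
    ∃ C : ℝ, 0 < C ∧
      ∀ {Ω : Type*} [MeasurableSpace Ω] (P : MeasureTheory.Measure Ω)
        [MeasureTheory.IsProbabilityMeasure P] (ζ : ℤ → Ω → ℂ)
        (_ : SignalDenoising.IsStdComplexNoise P ζ)
        (σ : ℝ) (_ : 0 < σ) (m n k₀ s : ℕ) (ρ κ : ℝ) (x : SignalDenoising.Signal)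
        (_ : 1 ≤ m) (_ : n = 2 * m)
        (_ : SignalDenoising.Interpolable P ζ σ m n k₀ ρ x)
        (_ : SignalDenoising.NearShiftInvariant n n σ s κ x)
        (α : ℝ) (_ : 0 < α) (_ : α < 1),
        ∃ Ξ : Set SignalDenoising.Signal, MeasurableSet Ξ ∧
          ENNReal.ofReal (1 - α) ≤ P {ω | (fun t => ζ t ω) ∈ Ξ} ∧
          ∀ z ∈ Ξ, ∀ φhat : SignalDenoising.Signal,
            SignalDenoising.IsInterpolatingLS n (2 * k₀) (2 * ρ)
              (SignalDenoising.observe x σ z) φhat →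
            SignalDenoising.l2Norm n (SignalDenoising.shift ((2 * k₀ : ℕ) : ℤ)
                (x - SignalDenoising.conv φhat (SignalDenoising.observe x σ z))) ^ 2
              ≤ C * (σ ^ 2 * (ρ ^ 2 * (1 + Real.log (1 / α))
                  + SignalDenoising.remainder n n ρ s κ α)) ∧
            ∀ t : ℤ, (m : ℤ) - 3 * k₀ ≤ t → t ≤ (n : ℤ) - 3 * k₀ →
              ‖x t - SignalDenoising.conv φhat (SignalDenoising.observe x σ z) t‖ ^ 2
                ≤ C * (σ ^ 2 * ρ / ((n : ℝ) + 1) * (ρ ^ 2 * (1 + Real.log (1 / α))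
                    + SignalDenoising.remainder n n ρ s κ α)) := by
  refine ⟨2704, by norm_num, fun {Ω} _ P _ ζ hζ σ hσ m n k₀ s ρ κ x hm hn hint hS α hα hα1 => ?_⟩
  obtain ⟨φ, hφ⟩ := hint.exists_isOracleFilter hζ hσ
  obtain ⟨hs, -, hκ, S, shift_one_mem, rfl, xS, ε, hxS, rfl, hε⟩ := hS
  have : FiniteDimensional ℂ S := Module.finite_of_finrank_pos hs
  obtain ⟨Ξ, good, measurable, mass_le⟩ := hφ.exists_goodNoise (S := S) hζ hn hε hα
  refine ⟨Ξ, measurable, mass_le, fun z hz φhat hLS => ?_⟩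
  have l2Norm_le := (good hz).l2Norm_error_sq_le hφ hm hn hκ hσ.le hα hα1
    (fun τ => SignalDenoising.shift_mem_of_shift_one_mem shift_one_mem τ hxS) hLS
  have rate_nonneg := SignalDenoising.errorRate_nonneg (n := n) (s := Module.finrank ℂ S) (by lia)
    (zero_le_one.trans hφ.one_le) hκ hα hα1
  refine ⟨l2Norm_le.trans ?_, fun t ht ht' => ?_⟩
  · exact mul_le_mul_of_nonneg_right (by norm_num) (mul_nonneg (sq_nonneg σ) rate_nonneg)
  · exact (good hz).norm_error_apply_sq_le hφ hm hn hκ hα hα1 hLS.1 l2Norm_le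
      (Finset.mem_Icc.mpr ⟨ht, ht'⟩)
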